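/- **Theorem.** For a continuous $f:\mathbb R^2\to\mathbb C$ supported in the parabolic region $\{(x,y): y\ge x^2\}$ let $$R[f](\xi,\eta)=\int_{\mathbb R} f(x,\xi x+\eta)\,dx$$ be its Radon transform. For $\varepsilon>0$, $\gamma>0$ let $\|\cdot\|_{\varepsilon,\gamma}$ be a family of norms, possibly taking the value $\infty$, on continuous functions $g=g(\xi,\eta)$ that is increasing in $\varepsilon$ and in $\gamma$ and satisfies, for some constant $c>0$ and all $\varepsilon>0$, $0<\gamma<1$, $$\|g\|_{\varepsilon,\gamma}\ \ge\ c\,\max\Big\{\int_{|\xi|\le\varepsilon}\int_{|\eta|<\gamma}|g(\xi,\eta)|\,d\eta\,d\xi,\ \int_{|\xi|\le\varepsilon}|g(\xi,\gamma)|\,d\xi\Big\}$$ (for example $\|g\|_{\varepsilon,\gamma}=\sup_{|\eta|\le\gamma}\int_{|\xi|\le\varepsilon}|g(\xi,\eta)|\,d\xi$); no property of a norm other than these two is needed. For every $C_0\ge 0$ there is a constant $M>0$, depending only on $C_0$, such that the following holds for every $0<\alpha\le1$, every such family $\|\cdot\|_{\varepsilon,\gamma}$, every $0<\gamma<1$ and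 every $\varepsilon>0$. There is $\delta>0$, depending on $C_0,\alpha,\gamma,\varepsilon$ and the family of norms but not on $f$, such that for every $f:\mathbb R^2\to\mathbb C$ with $$|f(\mathbf x)-f(\mathbf y)|\le C_0\|\mathbf x-\mathbf y\|^\alpha\quad(\mathbf x,\mathbf y\in\mathbb R^2),\qquad \operatorname{supp} f\subset\{(x,y): y\ge x^2\},$$ one has: 1. if $0<\|R[f]\|_{\varepsilon,\gamma}<\delta$, then $$\|f(\cdot,\gamma)\|_{L^2(\mathbb R)}\le M\left(\frac{\log\log\big(\|R[f]\|_{\varepsilon,\gamma}^{-1}\big)}{\log\big(\|R[f]\|_{\varepsilon,\gamma}^{-1}\big)}\right)^{\alpha};$$ 2. if $\|R[f]\|_{\varepsilon,\gamma}=0$, then $f(x,\gamma)=0$ for all $x\in\mathbb R$. -/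

import Mathlib

open MeasureTheory Set
open scoped NNReal ENNReal

/-- The Radon transform of a function on the Euclidean plane in line coordinates:
`R[f](ξ, η) = ∫ f(x, ξ x + η) dx`. -/
noncomputable def radon (f : EuclideanSpace ℝ (Fin 2) → ℂ) : ℝ × ℝ → ℂ :=
  fun p => ∫ x : ℝ, f !₂[x, p.1 * x + p.2]

/-- The region `{(x, y) ; y ≥ x²}`. -/
def parabolicRegion : Set (EuclideanSpace ℝ (Fin 2)) :=
  {p | (p 0) ^ 2 ≤ p 1}

/-- The `L¹` norm of `g = g(ξ, η)` over the rectangle `|ξ| ≤ ε`, `|η| < γ`. -/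
noncomputable def rectL1 (ε γ : ℝ) (g : ℝ × ℝ → ℂ) : ℝ≥0∞ :=
  ∫⁻ p in Icc (-ε) ε ×ˢ Ioo (-γ) γ, ‖g p‖ₑ

/-- The `L¹[-ε, ε]` norm of the slice `g(·, η)`. -/
noncomputable def sliceL1 (ε η : ℝ) (g : ℝ × ℝ → ℂ) : ℝ≥0∞ :=
  ∫⁻ ξ in Icc (-ε) ε, ‖g (ξ, η)‖ₑ

/-- Admissible families `‖·‖_{ε,γ}` for measuring the data: they increase in `ε` and `γ` and
dominate, up to an absolute constant, the `L¹` norm over the rectangle and the `L¹` norm of the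
slice `η = γ` (for `0 < γ < 1`). The value `∞` is allowed and no norm axiom is required, so every
family of (extended) norms with these two properties is included, for instance
`‖g‖_{ε,γ} = sup_{|η| ≤ γ} ‖g(·, η)‖_{L¹[-ε, ε]}`. -/
structure IsDataNorm (N : ℝ → ℝ → (ℝ × ℝ → ℂ) → ℝ≥0∞) : Prop where
  mono : ∀ ε ε' γ γ' : ℝ, 0 < ε → ε ≤ ε' → 0 < γ → γ ≤ γ' →
    ∀ g : ℝ × ℝ → ℂ, Continuous g → N ε γ g ≤ N ε' γ' g
  dominates : ∃ c : ℝ≥0, 0 < c ∧ ∀ ε γ : ℝ, 0 < ε → 0 < γ → γ < 1 →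
    ∀ g : ℝ × ℝ → ℂ, Continuous g → c * max (rectL1 ε γ g) (sliceL1 ε γ g) ≤ N ε γ g

/-! Integrating the Radon data in `η` against the truncated power `(γ' - η)₊ᵐ / m!` gives the
integral of `f` against the ridge function `(γ' - y + ξ x)₊ᵐ / m!`
(`integral_truncPow_mul_lineIntegral`). Only `|η| < γ` enters: the power kills `η ≥ γ'`, and lines
of small slope with `η ≤ -γ` miss the support. Expanded in `ξ ∈ [0, ρ]`, the ridge integral is, up
to `O((2ρ)ᵐ)`, a polynomial of degree `< m` whose coefficients are moments of `f` against `xⁱ (γ' -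
y)₊^(m-i)`. Lagrange interpolation at `m` separated slopes, each picked by averaging so that its
data are small, bounds these moments (`norm_moment_le`).

To reach `f (x₀, γ)`, a Jackson polynomial `p` of degree at most `8n`, concentrated at scale `1/n`
around `x₀`, combines the moments with `m - i = n - 1` into the `n`-fold antiderivative of `a(y) = ∫
f(x, y) p(x) dx`, for `y ≤ γ`. Averaging `a` successively `n` times over backward windows of length
`n⁻²` changes it by `O(n^(-α))` from `f (x₀, γ)`, and expresses it by differences of that
antiderivative at the price `(2n²)ⁿ` (`norm_le_of_moment_le`).

With `ρ = n⁻¹⁰⁰`, extracting the `k`-th coefficient costs `ρ⁻ᵏ` against a remainder `ρᵐ`, `m = n - 1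
+ k`; what is left, `n^(-100(n-1))`, beats all other factors, while the data are amplified by at
most `n^(1000n)`. Hence `n` may be of order `L / log L` with `L = log (1/H)`, and `n^(-α)` becomes
the stated rate (`exists_log_threshold`). For zero data every large `n` is allowed. -/

/-! ### Truncated powers and their Taylor expansion -/

/-- The normalized truncated power `a₊ᵐ / m!`. -/
noncomputable def truncPow (m : ℕ) (a : ℝ) : ℝ := max a 0 ^ m / (m.factorial : ℝ)

lemma continuous_truncPow (m : ℕ) : Continuous (truncPow m) := by
  unfold truncPow; fun_prop

lemma truncPow_nonneg (m : ℕ) (a : ℝ) : 0 ≤ truncPow m a := by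
  unfold truncPow; positivity

lemma truncPow_of_nonneg (m : ℕ) {a : ℝ} (ha : 0 ≤ a) :
    truncPow m a = a ^ m / (m.factorial : ℝ) := by
  simp [truncPow, ha]

lemma truncPow_of_nonpos {m : ℕ} (hm : m ≠ 0) {a : ℝ} (ha : a ≤ 0) : truncPow m a = 0 := by
  simp [truncPow, ha, hm]

lemma truncPow_le_two_pow (m : ℕ) {a : ℝ} (ha : a ≤ 2) : truncPow m a ≤ 2 ^ m := by
  unfold truncPow
  refine (div_le_self (by positivity) (by exact_mod_cast Nat.factorial_pos m)).trans ?_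
  exact pow_le_pow_left₀ (le_max_right _ _) (max_le ha (by norm_num)) m

lemma add_pow_div_factorial (m : ℕ) (a b : ℝ) :
    (a + b) ^ m / (m.factorial : ℝ) =
      (∑ k ∈ Finset.range m, b ^ k / (k.factorial : ℝ) *
        (a ^ (m - k) / ((m - k).factorial : ℝ))) + b ^ m / (m.factorial : ℝ) := by
  have h : ∀ k ∈ Finset.range (m + 1), b ^ k * a ^ (m - k) * (m.choose k : ℝ) =
      m.factorial * (b ^ k / (k.factorial : ℝ) * (a ^ (m - k) / ((m - k).factorial : ℝ))) := by
    intro k hk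
    rw [Nat.cast_choose ℝ (Finset.mem_range_succ_iff.mp hk)]
    ring
  rw [add_comm a b, add_pow, Finset.sum_congr rfl h, ← Finset.mul_sum, Finset.sum_range_succ]
  have : (m.factorial : ℝ) ≠ 0 := by exact_mod_cast m.factorial_ne_zero
  simp only [Nat.sub_self, pow_zero, Nat.factorial_zero, Nat.cast_one, div_one, mul_one]
  field_simp

/-- For `0 ≤ a` the sum is the binomial expansion without its last term, and `|a + b| ≤ |b|` if `a +
b` is negative; for `a ≤ 0` the sum vanishes and `(a + b)₊ ≤ |b|`. Stopping at `k < m` avoids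
`truncPow 0`, which is constantly `1` rather than a step function. -/
lemma abs_truncPow_add_sub_sum_le {m : ℕ} (hm : m ≠ 0) (a b : ℝ) :
    |truncPow m (a + b) - ∑ k ∈ Finset.range m, b ^ k / (k.factorial : ℝ) * truncPow (m - k) a| ≤
      2 * |b| ^ m / (m.factorial : ℝ) := by
  have hfac : (0 : ℝ) < m.factorial := by exact_mod_cast m.factorial_pos
  rcases le_total 0 a with ha | ha
  · have hsum : ∑ k ∈ Finset.range m, b ^ k / (k.factorial : ℝ) * truncPow (m - k) a =
        (a + b) ^ m / (m.factorial : ℝ) - b ^ m / (m.factorial : ℝ) := by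
      rw [add_pow_div_factorial, add_sub_cancel_right]
      exact Finset.sum_congr rfl fun k _ => by rw [truncPow_of_nonneg _ ha]
    rw [hsum]
    have hb : |b ^ m / (m.factorial : ℝ)| = |b| ^ m / m.factorial := by
      rw [abs_div, abs_pow, abs_of_pos hfac]
    rcases le_total 0 (a + b) with hab | hab
    · rw [truncPow_of_nonneg _ hab, sub_sub_cancel, hb]
      gcongr
      nlinarith [pow_nonneg (abs_nonneg b) m]
    · rw [truncPow_of_nonpos hm hab, zero_sub, abs_neg]
      refine (abs_sub _ _).trans ?_
      rw [hb, abs_div, abs_pow, abs_of_pos hfac, two_mul, add_div]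
      have : |a + b| ≤ |b| := by
        rw [abs_of_nonpos hab, abs_of_nonpos (by linarith)]; linarith
      gcongr
  · have hsum : ∑ k ∈ Finset.range m, b ^ k / (k.factorial : ℝ) * truncPow (m - k) a = 0 :=
      Finset.sum_eq_zero fun k hk => by
        rw [truncPow_of_nonpos (Nat.sub_ne_zero_of_lt (Finset.mem_range.mp hk)) ha, mul_zero]
    rw [hsum, sub_zero, abs_of_nonneg (truncPow_nonneg _ _), truncPow]
    gcongr
    have h1 : max (a + b) 0 ≤ |b| :=
      max_le (by linarith [le_abs_self b]) (abs_nonneg b)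
    have h2 : max (a + b) 0 ^ m ≤ |b| ^ m := pow_le_pow_left₀ (le_max_right _ _) h1 m
    nlinarith [pow_nonneg (abs_nonneg b) m]

/-! ### Coefficients of a polynomial from its values -/

/-- Multiplying by `X - z` with `|z| ≤ 1` at most doubles the largest coefficient. -/
lemma norm_coeff_prod_linear_le {ι : Type*} (s : Finset ι) (a z : ι → ℂ) {c : ℝ}
    (ha : ∀ i ∈ s, ‖a i‖ ≤ c) (hz : ∀ i ∈ s, ‖z i‖ ≤ 1) (k : ℕ) :
    ‖(∏ i ∈ s, (Polynomial.C (a i) * (Polynomial.X - Polynomial.C (z i)))).coeff k‖ ≤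
      (2 * c) ^ s.card := by
  classical
  induction s using Finset.induction_on generalizing k with
  | empty =>
    simp only [Finset.prod_empty, Finset.card_empty, pow_zero, Polynomial.coeff_one]
    split_ifs <;> simp
  | insert i s his ih =>
    have IH := ih (fun j hj => ha j (Finset.mem_insert_of_mem hj))
      (fun j hj => hz j (Finset.mem_insert_of_mem hj))
    rw [Finset.prod_insert his, Finset.card_insert_of_notMem his]
    set P := ∏ i ∈ s, (Polynomial.C (a i) * (Polynomial.X - Polynomial.C (z i)))
    have hi := ha i (Finset.mem_insert_self i s)
    have hzi := hz i (Finset.mem_insert_self i s)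
    have hc : 0 ≤ c := (norm_nonneg _).trans hi
    have hX : ‖(Polynomial.X * P).coeff k‖ ≤ (2 * c) ^ s.card := by
      cases k with
      | zero => simp; positivity
      | succ k => rw [Polynomial.coeff_X_mul]; exact IH k
    rw [mul_assoc, Polynomial.coeff_C_mul, sub_mul, Polynomial.coeff_sub, Polynomial.coeff_C_mul,
      norm_mul, pow_succ']
    have : ‖(Polynomial.X * P).coeff k - z i * P.coeff k‖ ≤ 2 * (2 * c) ^ s.card := by
      refine (norm_sub_le _ _).trans ?_
      rw [norm_mul]
      have := mul_le_mul hzi (IH k) (norm_nonneg _) zero_le_one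
      linarith
    calc _ ≤ c * (2 * (2 * c) ^ s.card) := mul_le_mul hi this (norm_nonneg _) hc
      _ = _ := by ring

/-- A polynomial of degree `< m` that is small at `m` separated nodes has small coefficients. -/
lemma norm_coeff_le_of_norm_eval_le {m : ℕ} {Q : Polynomial ℂ} (hQ : Q.degree < m)
    (z : ℕ → ℝ) {s A : ℝ} (hs : 0 < s)
    (hsep : ∀ i < m, ∀ j < m, i ≠ j → s ≤ |z i - z j|) (hz : ∀ i < m, |z i| ≤ 1)
    (hA : ∀ i < m, ‖Q.eval (z i : ℂ)‖ ≤ A) (k : ℕ) :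
    ‖Q.coeff k‖ ≤ m * (A * (2 / s) ^ (m - 1)) := by
  have hinj : Set.InjOn (fun i => (z i : ℂ)) (Finset.range m : Set ℕ) := by
    intro i hi j hj hij
    by_contra hne
    have h := hsep i (by simpa using hi) j (by simpa using hj) hne
    have hij' : (z i : ℂ) = z j := hij
    have h' : z i = z j := by exact_mod_cast hij'
    rw [h', sub_self, abs_zero] at h
    linarith
  have hdeg : Q.degree < (Finset.range m).card := by simpa using hQ
  rw [Lagrange.eq_interpolate hinj hdeg, Lagrange.interpolate_apply, Polynomial.finsetSum_coeff]
  refine (norm_sum_le_of_le (f := fun i => _) (n := fun _ => A * (2 / s) ^ (m - 1)) _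
    fun i hi => ?_).trans (by simp)
  have hi' := Finset.mem_range.mp hi
  rw [Polynomial.coeff_C_mul, norm_mul]
  refine mul_le_mul (hA i hi') ?_ (norm_nonneg _) ((norm_nonneg _).trans (hA i hi'))
  -- The Lagrange basis polynomial at node `i` is the product of the `m - 1` factors `(z i - z j)⁻¹
  -- (X - z j)`.
  have h := norm_coeff_prod_linear_le ((Finset.range m).erase i)
    (fun j => ((z i : ℂ) - z j)⁻¹) (fun j => (z j : ℂ)) (c := s⁻¹) ?_ ?_ k
  · rw [Finset.card_erase_of_mem hi, Finset.card_range] at h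
    rw [div_eq_mul_inv]
    exact h
  · intro j hj
    rw [Finset.mem_erase, Finset.mem_range] at hj
    rw [norm_inv, ← Complex.ofReal_sub, Complex.norm_real]
    exact inv_anti₀ hs (hsep i hi' j hj.2 (Ne.symm hj.1))
  · intro j hj
    rw [Finset.mem_erase, Finset.mem_range] at hj
    rw [Complex.norm_real]
    exact hz j hj.2

/-! ### Backward averages as regularized differentiation -/

/-- The average of `φ` over the interval `[y - t, y]`. -/
noncomputable def backAvg (t : ℝ) (φ : ℝ → ℂ) (y : ℝ) : ℂ := (t : ℂ)⁻¹ * ∫ u in (y - t)..y, φ u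

lemma hasDerivAt_integral_of_continuous {φ : ℝ → ℂ} (hφ : Continuous φ) (a y : ℝ) :
    HasDerivAt (fun y => ∫ u in a..y, φ u) (φ y) y :=
  intervalIntegral.integral_hasDerivAt_right (hφ.intervalIntegrable _ _)
    hφ.aestronglyMeasurable.stronglyMeasurableAtFilter hφ.continuousAt

lemma backAvg_eq_of_hasDerivAt {t : ℝ} {φ Φ : ℝ → ℂ} (hφ : Continuous φ)
    (h : ∀ y, HasDerivAt Φ (φ y) y) (y : ℝ) :
    backAvg t φ y = (t : ℂ)⁻¹ * (Φ y - Φ (y - t)) := by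
  rw [backAvg, intervalIntegral.integral_eq_sub_of_hasDerivAt (fun x _ => h x)
    (hφ.intervalIntegrable _ _)]

lemma continuous_backAvg {φ : ℝ → ℂ} (hφ : Continuous φ) (t : ℝ) : Continuous (backAvg t φ) := by
  have h := hasDerivAt_integral_of_continuous hφ 0
  have hc : Continuous fun y => ∫ u in (0 : ℝ)..y, φ u :=
    continuous_iff_continuousAt.mpr fun y => (h y).continuousAt
  rw [funext (backAvg_eq_of_hasDerivAt (t := t) hφ h)]
  fun_prop

/-- Iterated averages of the `N`-th derivative of `Ψ N` are bounded by values of `Ψ N`. -/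
lemma norm_iterate_backAvg_le {t : ℝ} (ht : 0 < t) (N : ℕ) (y₀ : ℝ) {E : ℝ} (Ψ : ℕ → ℝ → ℂ)
    (h₀ : Continuous (Ψ 0)) (hΨ : ∀ j y, HasDerivAt (Ψ (j + 1)) (Ψ j y) y)
    (hE : ∀ y ∈ Icc (y₀ - N * t) y₀, ‖Ψ N y‖ ≤ E) :
    ‖(backAvg t)^[N] (Ψ 0) y₀‖ ≤ (2 / t) ^ N * E := by
  induction N generalizing Ψ E with
  | zero => simpa using hE y₀ (by simp)
  | succ N ih =>
    rw [Function.iterate_succ_apply]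
    have hchain : backAvg t (Ψ 0) = fun y => (t : ℂ)⁻¹ * (Ψ 1 y - Ψ 1 (y - t)) :=
      funext (backAvg_eq_of_hasDerivAt h₀ (hΨ 0))
    -- The average of a derivative is a difference quotient, so the difference quotients of `Ψ (j +
    -- 1)` form a new chain of antiderivatives, whose top is bounded with one more factor `2 / t`.
    have key := ih (E := 2 / t * E) (fun j y => (t : ℂ)⁻¹ * (Ψ (j + 1) y - Ψ (j + 1) (y - t))) ?_ ?_ ?_
    · simp only [zero_add] at key
      rw [hchain]
      refine key.trans (le_of_eq ?_)
      rw [pow_succ]; ring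
    · simp only [zero_add]
      rw [← hchain]
      exact continuous_backAvg h₀ t
    · intro j y
      have h := (hΨ (j + 1) (y - t)).comp_sub_const y t
      exact ((hΨ (j + 1) y).sub h).const_mul _
    · intro y hy
      push_cast at hE
      have e1 := hE y ⟨by nlinarith [hy.1], hy.2⟩
      have e2 := hE (y - t) ⟨by nlinarith [hy.1], by linarith [hy.2]⟩
      rw [norm_mul, norm_inv, Complex.norm_real, Real.norm_of_nonneg ht.le, div_eq_inv_mul,
        mul_assoc]
      gcongr
      refine (norm_sub_le _ _).trans ?_
      linarith

/-- Each average looks back by `t` only and preserves closeness to a constant. -/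
lemma norm_iterate_backAvg_sub_le {t : ℝ} (ht : 0 < t) (N : ℕ) (y₀ : ℝ) {e : ℝ} {φ : ℝ → ℂ} (c : ℂ)
    (hφ : Continuous φ) (he : ∀ y ∈ Icc (y₀ - N * t) y₀, ‖φ y - c‖ ≤ e) :
    ‖(backAvg t)^[N] φ y₀ - c‖ ≤ e := by
  induction N generalizing φ with
  | zero => simpa using he y₀ (by simp)
  | succ N ih =>
    rw [Function.iterate_succ_apply]
    refine ih (continuous_backAvg hφ t) fun y hy => ?_
    push_cast at he
    have htc : (t : ℂ) ≠ 0 := by exact_mod_cast ht.ne'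
    have heq : backAvg t φ y - c = (t : ℂ)⁻¹ * ∫ u in (y - t)..y, (φ u - c) := by
      rw [intervalIntegral.integral_sub (hφ.intervalIntegrable _ _) (by simp)]
      simp [backAvg, mul_sub, htc]
    have hint := intervalIntegral.norm_integral_le_of_norm_le_const (a := y - t) (b := y)
      (f := fun u => φ u - c) (C := e) fun u hu => by
        rw [uIoc_of_le (by linarith)] at hu
        exact he u ⟨by nlinarith [hy.1, hu.1], hu.2.trans hy.2⟩
    rw [heq, norm_mul, norm_inv, Complex.norm_real, Real.norm_of_nonneg ht.le]
    rw [sub_sub_cancel, abs_of_pos ht] at hint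
    rw [inv_mul_le_iff₀ ht]
    linarith

/-! ### Iterated antiderivatives -/

/-- The `j`-fold antiderivative of `φ` based at `a`. -/
noncomputable def iterIntegral (a : ℝ) (φ : ℝ → ℂ) : ℕ → ℝ → ℂ
  | 0 => φ
  | j + 1 => fun y => ∫ u in a..y, iterIntegral a φ j u

lemma continuous_iterIntegral {φ : ℝ → ℂ} (hφ : Continuous φ) (a : ℝ) (j : ℕ) :
    Continuous (iterIntegral a φ j) := by
  induction j with
  | zero => exact hφ
  | succ j ih =>
    exact continuous_iff_continuousAt.mpr fun y =>
      (hasDerivAt_integral_of_continuous ih a y).continuousAt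

lemma iterIntegral_succ' (a : ℝ) (φ : ℝ → ℂ) (j : ℕ) :
    iterIntegral a φ (j + 1) = iterIntegral a (iterIntegral a φ 1) j := by
  induction j with
  | zero => rfl
  | succ j ih => funext y; simp only [iterIntegral] at ih ⊢; rw [ih]

/-- Cauchy's formula for repeated integration. -/
lemma iterIntegral_succ_eq {φ : ℝ → ℂ} (hφ : Continuous φ) (a : ℝ) (j : ℕ) (y : ℝ) :
    iterIntegral a φ (j + 1) y =
      ∫ u in a..y, (((y - u) ^ j / (j.factorial : ℝ) : ℝ) : ℂ) * φ u := by
  induction j generalizing φ with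
  | zero => simp [iterIntegral]
  | succ j ih =>
    rw [iterIntegral_succ', ih (continuous_iterIntegral hφ a 1)]
    have hu : ∀ x ∈ uIcc a y, HasDerivAt
        (fun u : ℝ => (((y - u) ^ (j + 1) / ((j + 1).factorial : ℝ) : ℝ) : ℂ))
        ((-((y - x) ^ j / (j.factorial : ℝ)) : ℝ) : ℂ) x := by
      intro x _
      have h := ((((hasDerivAt_id x).const_sub y).pow (j + 1)).div_const
        ((j + 1).factorial : ℝ)).ofReal_comp
      refine h.congr_deriv ?_
      congr 1
      rw [Nat.factorial_succ]
      push_cast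
      have : (j.factorial : ℝ) ≠ 0 := by exact_mod_cast j.factorial_ne_zero
      simp only [id]
      field_simp
    have hv : ∀ x ∈ uIcc a y, HasDerivAt (iterIntegral a φ 1) (φ x) x :=
      fun x _ => hasDerivAt_integral_of_continuous hφ a x
    have h := intervalIntegral.integral_mul_deriv_eq_deriv_mul hu hv
      (Continuous.intervalIntegrable (by fun_prop) _ _) (hφ.intervalIntegrable _ _)
    rw [h]
    simp [iterIntegral, intervalIntegral.integral_neg]

/-- Truncation extends the Cauchy kernel by zero beyond `y`, so that the domain of integration no
longer depends on `y`. -/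
lemma iterIntegral_eq_truncPow {φ : ℝ → ℂ} (hφ : Continuous φ) {a b y : ℝ} (hab : y ∈ Icc a b)
    {j : ℕ} (hj : j ≠ 0) :
    iterIntegral a φ (j + 1) y = ∫ u in a..b, (truncPow j (y - u) : ℂ) * φ u := by
  have hc : Continuous fun u => (truncPow j (y - u) : ℂ) * φ u := by
    have := continuous_truncPow j
    fun_prop
  rw [iterIntegral_succ_eq hφ, ← intervalIntegral.integral_add_adjacent_intervals
    (hc.intervalIntegrable a y) (hc.intervalIntegrable y b)]
  have h2 : ∫ u in y..b, (truncPow j (y - u) : ℂ) * φ u = 0 := by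
    rw [intervalIntegral.integral_congr (g := fun _ => (0 : ℂ))]
    · simp
    · intro u hu
      rw [uIcc_of_le hab.2] at hu
      simp [truncPow_of_nonpos hj (sub_nonpos.mpr hu.1)]
  rw [h2, add_zero]
  refine intervalIntegral.integral_congr fun u hu => ?_
  rw [uIcc_of_le hab.1] at hu
  simp only [truncPow_of_nonneg j (sub_nonneg.mpr hu.2)]

/-! ### Sums of absolute values of coefficients -/

/-- The coefficients of `p` are dominated by those of a polynomial whose value at `1` is at most
`B`, so that the sum of their absolute values is at most `B`. -/
def CoeffBound (p : Polynomial ℝ) (B : ℝ) : Prop :=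
  ∃ q : Polynomial ℝ, (∀ k, |p.coeff k| ≤ q.coeff k) ∧ q.eval 1 ≤ B

lemma eval_one_nonneg_of_coeff_nonneg {q : Polynomial ℝ} (hq : ∀ k, 0 ≤ q.coeff k) :
    0 ≤ q.eval 1 := by
  rw [Polynomial.eval_eq_sum_range]
  exact Finset.sum_nonneg fun k _ => by simpa using hq k

namespace CoeffBound

lemma mono {p : Polynomial ℝ} {B B' : ℝ} (h : CoeffBound p B) (hB : B ≤ B') : CoeffBound p B' :=
  let ⟨q, h1, h2⟩ := h
  ⟨q, h1, h2.trans hB⟩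

lemma add {p r : Polynomial ℝ} {A B : ℝ} (hp : CoeffBound p A) (hr : CoeffBound r B) :
    CoeffBound (p + r) (A + B) := by
  obtain ⟨q, h1, h2⟩ := hp
  obtain ⟨s, h3, h4⟩ := hr
  refine ⟨q + s, fun k => ?_, by simpa using add_le_add h2 h4⟩
  simp only [Polynomial.coeff_add]
  exact (abs_add_le _ _).trans (add_le_add (h1 k) (h3 k))

lemma neg {p : Polynomial ℝ} {A : ℝ} (hp : CoeffBound p A) : CoeffBound (-p) A :=
  let ⟨q, h1, h2⟩ := hp
  ⟨q, fun k => by simpa using h1 k, h2⟩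

lemma sub {p r : Polynomial ℝ} {A B : ℝ} (hp : CoeffBound p A) (hr : CoeffBound r B) :
    CoeffBound (p - r) (A + B) := by
  rw [sub_eq_add_neg]; exact hp.add hr.neg

lemma mul {p r : Polynomial ℝ} {A B : ℝ} (hp : CoeffBound p A) (hr : CoeffBound r B) :
    CoeffBound (p * r) (A * B) := by
  obtain ⟨q, h1, h2⟩ := hp
  obtain ⟨s, h3, h4⟩ := hr
  have hq := eval_one_nonneg_of_coeff_nonneg fun k => (abs_nonneg _).trans (h1 k)
  have hs := eval_one_nonneg_of_coeff_nonneg fun k => (abs_nonneg _).trans (h3 k)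
  refine ⟨q * s, fun k => ?_, ?_⟩
  · rw [Polynomial.coeff_mul, Polynomial.coeff_mul]
    refine (Finset.abs_sum_le_sum_abs _ _).trans (Finset.sum_le_sum fun i _ => ?_)
    rw [abs_mul]
    exact mul_le_mul (h1 _) (h3 _) (abs_nonneg _) ((abs_nonneg _).trans (h1 _))
  · rw [Polynomial.eval_mul]
    exact mul_le_mul h2 h4 hs (hq.trans h2)

lemma const (a : ℝ) : CoeffBound (Polynomial.C a) |a| := by
  refine ⟨Polynomial.C |a|, fun k => ?_, by simp⟩
  simp only [Polynomial.coeff_C]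
  split_ifs <;> simp

lemma X : CoeffBound Polynomial.X 1 := by
  refine ⟨Polynomial.X, fun k => ?_, by simp⟩
  simp only [Polynomial.coeff_X]
  split_ifs <;> simp

lemma pow {p : Polynomial ℝ} {A : ℝ} (hp : CoeffBound p A) (n : ℕ) :
    CoeffBound (p ^ n) (A ^ n) := by
  induction n with
  | zero => simpa using const 1
  | succ n ih => rw [pow_succ, pow_succ]; exact ih.mul hp

lemma sum_abs_coeff_le {p : Polynomial ℝ} {B : ℝ} (h : CoeffBound p B) (d : ℕ) :
    ∑ k ∈ Finset.range d, |p.coeff k| ≤ B := by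
  obtain ⟨q, h1, h2⟩ := h
  refine le_trans ?_ h2
  rw [Polynomial.eval_eq_sum_range' (n := max d (q.natDegree + 1)) (by simp)]
  simp only [one_pow, mul_one]
  exact (Finset.sum_le_sum fun k _ => h1 k).trans
    (Finset.sum_le_sum_of_subset_of_nonneg (by simp) fun k _ _ => (abs_nonneg _).trans (h1 k))

end CoeffBound

/-! ### The Jackson kernel -/

/-- `sin ((2 n + 1) θ) / sin θ` as a function of `v = sin θ`. -/
noncomputable def sinRatio : ℕ → ℝ → ℝ
  | 0, _ => 1
  | 1, v => 3 - 4 * v ^ 2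
  | n + 2, v => (2 - 4 * v ^ 2) * sinRatio (n + 1) v - sinRatio n v

/-- The polynomial `sinRatio n` evaluated at the polynomial `V`. -/
noncomputable def sinRatioPoly (V : Polynomial ℝ) : ℕ → Polynomial ℝ
  | 0 => 1
  | 1 => Polynomial.C 3 - Polynomial.C 4 * V ^ 2
  | n + 2 => (Polynomial.C 2 - Polynomial.C 4 * V ^ 2) * sinRatioPoly V (n + 1) - sinRatioPoly V n

lemma eval_sinRatioPoly (V : Polynomial ℝ) (x : ℝ) :
    ∀ n, (sinRatioPoly V n).eval x = sinRatio n (V.eval x)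
  | 0 => by simp [sinRatioPoly, sinRatio]
  | 1 => by simp [sinRatioPoly, sinRatio]
  | n + 2 => by
    simp [sinRatioPoly, sinRatio, eval_sinRatioPoly V x (n + 1), eval_sinRatioPoly V x n]

lemma natDegree_sinRatioPoly_le {V : Polynomial ℝ} (hV : V.natDegree ≤ 1) :
    ∀ n, (sinRatioPoly V n).natDegree ≤ 2 * n
  | 0 => by simp [sinRatioPoly]
  | 1 => by
    unfold sinRatioPoly
    compute_degree
    omega
  | n + 2 => by
    have h1 := natDegree_sinRatioPoly_le hV (n + 1)
    have h0 := natDegree_sinRatioPoly_le hV n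
    have hq : (Polynomial.C 2 - Polynomial.C 4 * V ^ 2).natDegree ≤ 2 := by
      compute_degree
      omega
    unfold sinRatioPoly
    refine (Polynomial.natDegree_sub_le _ _).trans (max_le ?_ (by omega))
    exact Polynomial.natDegree_mul_le.trans (by omega)

/-- The recursion multiplies by a polynomial of coefficient sum at most `2 + 4` and subtracts one
earlier term, and `6 * 7 + 1 ≤ 7 ^ 2`. -/
lemma coeffBound_sinRatioPoly {V : Polynomial ℝ} (hV : CoeffBound V 1) :
    ∀ n, CoeffBound (sinRatioPoly V n) (7 ^ n)
  | 0 => by simpa [sinRatioPoly] using CoeffBound.const 1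
  | 1 => by
    unfold sinRatioPoly
    exact ((CoeffBound.const 3).sub ((CoeffBound.const 4).mul (hV.pow 2))).mono (by norm_num)
  | n + 2 => by
    have h1 := coeffBound_sinRatioPoly hV (n + 1)
    have h0 := coeffBound_sinRatioPoly hV n
    unfold sinRatioPoly
    refine ((((CoeffBound.const 2).sub ((CoeffBound.const 4).mul (hV.pow 2))).mul h1).sub
      h0).mono ?_
    norm_num
    rw [pow_succ, pow_add]
    nlinarith [pow_pos (show (0 : ℝ) < 7 by norm_num) n]

/-- The recursion is the addition formula `sin (φ + 2θ) + sin (φ - 2θ) = 2 cos (2θ) sin φ` with `2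
cos (2θ) = 2 - 4 sin² θ`. -/
lemma sinRatio_sin_mul_sin (θ : ℝ) :
    ∀ n : ℕ, sinRatio n (Real.sin θ) * Real.sin θ = Real.sin ((2 * n + 1) * θ)
  | 0 => by simp [sinRatio]
  | 1 => by
    rw [show (2 * ((1 : ℕ) : ℝ) + 1) * θ = 3 * θ by push_cast; ring, Real.sin_three_mul]
    simp only [sinRatio]; ring
  | n + 2 => by
    have h1 := sinRatio_sin_mul_sin θ (n + 1)
    have h0 := sinRatio_sin_mul_sin θ n
    simp only [sinRatio]
    rw [sub_mul, mul_assoc, h1, h0]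
    push_cast
    have e1 : (2 * ((n : ℝ) + 2) + 1) * θ = (2 * ((n : ℝ) + 1) + 1) * θ + 2 * θ := by ring
    have e2 : (2 * (n : ℝ) + 1) * θ = (2 * ((n : ℝ) + 1) + 1) * θ - 2 * θ := by ring
    rw [e1, e2, Real.sin_add, Real.sin_sub, Real.cos_two_mul, Real.cos_sq']
    ring

lemma sinRatio_abs (v : ℝ) : ∀ n, sinRatio n |v| = sinRatio n v
  | 0 => rfl
  | 1 => by simp [sinRatio]
  | n + 2 => by simp [sinRatio, sinRatio_abs v (n + 1), sinRatio_abs v n]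

lemma sinRatio_zero : ∀ n : ℕ, sinRatio n 0 = 2 * n + 1
  | 0 => by simp [sinRatio]
  | 1 => by norm_num [sinRatio]
  | n + 2 => by
    simp only [sinRatio, sinRatio_zero (n + 1), sinRatio_zero n]
    push_cast; ring

lemma abs_sin_natCast_mul_le (k : ℕ) (θ : ℝ) : |Real.sin (k * θ)| ≤ k * |Real.sin θ| := by
  induction k with
  | zero => simp
  | succ k ih =>
    push_cast
    rw [add_mul, one_mul, Real.sin_add]
    refine (abs_add_le _ _).trans ?_
    rw [abs_mul, abs_mul]
    have h1 := mul_le_mul_of_nonneg_left (Real.abs_cos_le_one θ) (abs_nonneg (Real.sin (k * θ)))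
    have h2 := mul_le_mul_of_nonneg_right (Real.abs_cos_le_one (k * θ)) (abs_nonneg (Real.sin θ))
    linarith

lemma abs_sinRatio_mul_abs_le {v : ℝ} (hv : |v| ≤ 1) (n : ℕ) : |sinRatio n v| * |v| ≤ 1 := by
  have h := sinRatio_sin_mul_sin (Real.arcsin v) n
  rw [Real.sin_arcsin (abs_le.mp hv).1 (abs_le.mp hv).2] at h
  rw [← abs_mul, h]
  exact Real.abs_sin_le_one _

lemma abs_sinRatio_le {v : ℝ} (hv : |v| ≤ 1) (n : ℕ) : |sinRatio n v| ≤ 2 * n + 1 := by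
  rcases eq_or_ne v 0 with rfl | hv0
  · rw [sinRatio_zero, abs_of_nonneg (by positivity)]
  · have h := sinRatio_sin_mul_sin (Real.arcsin v) n
    have h2 := abs_sin_natCast_mul_le (2 * n + 1) (Real.arcsin v)
    push_cast at h2
    rw [← h, Real.sin_arcsin (abs_le.mp hv).1 (abs_le.mp hv).2, abs_mul] at h2
    exact le_of_mul_le_mul_right h2 (abs_pos.mpr hv0)

/-- Jordan's inequality `2x/π ≤ sin x`, used once to get `arcsin |v| ≤ π|v|/2` and again at `(2n +
1) arcsin |v| ≤ π/2`. -/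
lemma natCast_le_sinRatio {v : ℝ} (n : ℕ) (hv : (2 * n + 1) * |v| ≤ 1) : (n : ℝ) ≤ sinRatio n v := by
  rcases eq_or_ne v 0 with rfl | hv0
  · rw [sinRatio_zero]; linarith [n.cast_nonneg (α := ℝ)]
  · rw [← sinRatio_abs]
    have hpos := abs_pos.mpr hv0
    set w := |v|
    have hn : (0 : ℝ) ≤ n := n.cast_nonneg
    have hw1 : w ≤ 1 := by nlinarith
    have hs := Real.sin_arcsin (by linarith : -1 ≤ w) hw1
    have h := sinRatio_sin_mul_sin (Real.arcsin w) n
    rw [hs] at h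
    have hθ0 : 0 ≤ Real.arcsin w := Real.arcsin_nonneg.mpr hpos.le
    have hθ : 2 / Real.pi * Real.arcsin w ≤ w := by
      conv_rhs => rw [← hs]
      exact Real.mul_le_sin hθ0 (Real.arcsin_le_pi_div_two w)
    have hwθ : w ≤ Real.arcsin w := by
      conv_lhs => rw [← hs]
      exact Real.sin_le hθ0
    have hpi := Real.pi_pos
    have hθ' : Real.arcsin w ≤ Real.pi / 2 * w := by
      rw [div_mul_eq_mul_div, div_le_iff₀ hpi] at hθ
      linarith
    have key := Real.mul_le_sin (x := (2 * n + 1) * Real.arcsin w) (by positivity) (by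
      nlinarith [mul_le_mul_of_nonneg_left hθ' (by positivity : (0 : ℝ) ≤ 2 * n + 1)])
    rw [← h] at key
    refine le_of_mul_le_mul_right (a := w) ?_ hpos
    refine le_trans ?_ key
    have h2 : (1 : ℝ) / 2 ≤ 2 / Real.pi := by
      rw [div_le_div_iff₀ (by norm_num) hpi]; linarith [Real.pi_le_four]
    calc (n : ℝ) * w ≤ 1 / 2 * ((2 * n + 1) * w) := by nlinarith
      _ ≤ 2 / Real.pi * ((2 * n + 1) * Real.arcsin w) := by gcongr

lemma exists_subinterval_near {x₀ h : ℝ} (hx : x₀ ∈ Icc (-1 : ℝ) 1) (h0 : 0 ≤ h) (h1 : h ≤ 1) :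
    ∃ a, -1 ≤ a ∧ a + h ≤ 1 ∧ ∀ x ∈ Icc a (a + h), |x₀ - x| ≤ h := by
  rcases le_total x₀ 0 with h2 | h2
  · exact ⟨x₀, hx.1, by linarith, fun x hx' => abs_le.mpr ⟨by linarith [hx'.2], by linarith [hx'.1]⟩⟩
  · exact ⟨x₀ - h, by linarith, by linarith [hx.2],
      fun x hx' => abs_le.mpr ⟨by linarith [hx'.2], by linarith [hx'.1]⟩⟩

lemma integral_lorentzian_le_pi {n : ℝ} (x₀ : ℝ) :
    ∫ x in (-1 : ℝ)..1, n / (1 + (n * (x₀ - x)) ^ 2) ≤ Real.pi := by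
  have hd : ∀ x ∈ uIcc (-1 : ℝ) 1, HasDerivAt (fun x => -Real.arctan (n * (x₀ - x)))
      (n / (1 + (n * (x₀ - x)) ^ 2)) x := by
    intro x _
    have h := ((((hasDerivAt_id x).const_sub x₀).const_mul n).arctan).neg
    refine h.congr_deriv ?_
    simp only [id]
    ring
  rw [intervalIntegral.integral_eq_sub_of_hasDerivAt hd]
  · have h1 := Real.neg_pi_div_two_lt_arctan (n * (x₀ - 1))
    have h2 := Real.arctan_lt_pi_div_two (n * (x₀ - -1))
    linarith
  · refine Continuous.intervalIntegrable ?_ _ _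
    exact continuous_const.div (by fun_prop) fun x => by positivity

/-- A polynomial approximate identity of Jackson type on `[-1, 1]`. -/
lemma exists_jackson_polynomial {n : ℕ} (hn : 2 ≤ n) {x₀ : ℝ} (hx₀ : x₀ ∈ Icc (-1 : ℝ) 1) :
    ∃ p : Polynomial ℝ, p.natDegree ≤ 8 * n ∧
      (∀ d, ∑ k ∈ Finset.range d, |p.coeff k| ≤ 7 ^ (4 * n)) ∧ (∀ x, 0 ≤ p.eval x) ∧
      ∫ x in (-1 : ℝ)..1, p.eval x = 1 ∧
      ∫ x in (-1 : ℝ)..1, p.eval x * (1 + n * |x₀ - x|) ≤ 1600 := by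
  have hn' : (2 : ℝ) ≤ n := by exact_mod_cast hn
  -- Halving keeps `|V| ≤ 1` on `[-1, 1]`, so that `V` is a sine there, and its coefficient sum at
  -- most `1`.
  set V : Polynomial ℝ := Polynomial.C (x₀ / 2) - Polynomial.C (1 / 2) * Polynomial.X with hV
  have hVeval : ∀ x, V.eval x = (x₀ - x) / 2 := fun x => by simp [hV]; ring
  have hVdeg : V.natDegree ≤ 1 := by rw [hV]; compute_degree
  have hVcoeff : CoeffBound V 1 := by
    refine ((CoeffBound.const _).sub ((CoeffBound.const _).mul CoeffBound.X)).mono ?_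
    have := abs_le.mpr ⟨hx₀.1, hx₀.2⟩
    rw [abs_div]
    norm_num
    linarith
  -- `sinRatio` is bounded by both `3n` and `1/|v|`. Its fourth power leaves `n⁴ / (1 + (n (x₀ -
  -- x))²)`, up to a constant, even after multiplication by `1 + n |x₀ - x|`.
  set K : Polynomial ℝ := sinRatioPoly V n ^ 4 with hK
  have hKeval : ∀ x, K.eval x = sinRatio n ((x₀ - x) / 2) ^ 4 := fun x => by
    rw [hK, Polynomial.eval_pow, eval_sinRatioPoly, hVeval]
  have hK0 : ∀ x, 0 ≤ K.eval x := fun x => by rw [hKeval]; positivity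
  have hKc : Continuous fun x => K.eval x := K.continuous
  set Z := ∫ x in (-1 : ℝ)..1, K.eval x with hZ
  -- The kernel is at least `n⁴` on an interval of length `2 / (2n + 1)` close to `x₀`.
  have hZlow : 2 / 3 * (n : ℝ) ^ 3 ≤ Z := by
    set h : ℝ := 2 / (2 * n + 1) with hh
    have hh0 : 0 < h := by positivity
    have hh1 : h ≤ 1 := by rw [hh, div_le_one (by positivity)]; linarith
    obtain ⟨a, ha1, ha2, ha⟩ := exists_subinterval_near hx₀ hh0.le hh1
    have hsub : ∫ x in a..(a + h), K.eval x ≤ Z := by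
      refine intervalIntegral.integral_mono_interval ha1 (by linarith) ha2 ?_
        (hKc.intervalIntegrable _ _)
      exact Filter.Eventually.of_forall hK0
    have hlow : ∫ x in a..(a + h), (n : ℝ) ^ 4 ≤ ∫ x in a..(a + h), K.eval x := by
      refine intervalIntegral.integral_mono_on (by linarith) (by simp)
        (hKc.intervalIntegrable _ _) fun x hx => ?_
      rw [hKeval]
      refine pow_le_pow_left₀ (by positivity) (natCast_le_sinRatio n ?_) 4
      rw [abs_div, abs_two]
      have := ha x hx
      calc (2 * (n : ℝ) + 1) * (|x₀ - x| / 2) ≤ (2 * n + 1) * (h / 2) := by gcongr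
        _ = 1 := by rw [hh]; field_simp
    rw [intervalIntegral.integral_const, add_sub_cancel_left, smul_eq_mul] at hlow
    refine le_trans ?_ (hlow.trans hsub)
    rw [hh, div_mul_eq_mul_div 2 (2 * (n : ℝ) + 1), le_div_iff₀ (by positivity)]
    nlinarith [pow_pos (by linarith : (0 : ℝ) < n) 3]
  have hn3 : (8 : ℝ) ≤ (n : ℝ) ^ 3 := by
    calc (8 : ℝ) = 2 ^ 3 := by norm_num
      _ ≤ _ := pow_le_pow_left₀ (by norm_num) hn' 3
  have hZ1 : 1 ≤ Z := by linarith
  have hup : ∫ x in (-1 : ℝ)..1, K.eval x * (1 + n * |x₀ - x|) ≤ 1000 * (n : ℝ) ^ 3 := by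
    have hmono : ∫ x in (-1 : ℝ)..1, K.eval x * (1 + n * |x₀ - x|) ≤
        ∫ x in (-1 : ℝ)..1, 507 / 2 * (n : ℝ) ^ 3 * (n / (1 + (n * (x₀ - x)) ^ 2)) := by
      refine intervalIntegral.integral_mono_on (by norm_num)
        (Continuous.intervalIntegrable (by fun_prop) _ _) (Continuous.intervalIntegrable ?_ _ _)
        fun x hx => ?_
      · exact continuous_const.mul (continuous_const.div (by fun_prop) fun x => by positivity)
      · rw [hKeval]
        have hv : |(x₀ - x) / 2| ≤ 1 := by
          rw [abs_le]; constructor <;> linarith [hx.1, hx.2, hx₀.1, hx₀.2]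
        have h1 := abs_sinRatio_le hv n
        have h2 := abs_sinRatio_mul_abs_le hv n
        set w := sinRatio n ((x₀ - x) / 2)
        have h1' : w ^ 2 ≤ 9 * (n : ℝ) ^ 2 := by
          have : |w| ≤ 3 * n := by linarith
          have := pow_le_pow_left₀ (abs_nonneg w) this 2
          rw [sq_abs] at this; linarith
        have h2' : w ^ 2 * (x₀ - x) ^ 2 ≤ 4 := by
          rw [← abs_mul] at h2
          have := pow_le_pow_left₀ (abs_nonneg _) h2 2
          rw [sq_abs] at this; nlinarith
        set b := (n : ℝ) * |x₀ - x| with hb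
        have hb2 : (n * (x₀ - x)) ^ 2 = b ^ 2 := by rw [hb, mul_pow, mul_pow, sq_abs]
        have hb0 : 0 ≤ b := by positivity
        have h3 : w ^ 2 * (1 + b ^ 2) ≤ 13 * (n : ℝ) ^ 2 := by
          rw [← hb2, mul_pow]
          nlinarith [mul_le_mul_of_nonneg_left h2' (sq_nonneg (n : ℝ))]
        rw [hb2, ← mul_div_assoc, le_div_iff₀ (by positivity)]
        have h4 : (1 + b) ≤ 3 / 2 * (1 + b ^ 2) := by nlinarith [sq_nonneg (b - 1 / 3)]
        have h5 : (w ^ 2 * (1 + b ^ 2)) ^ 2 ≤ (13 * (n : ℝ) ^ 2) ^ 2 :=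
          pow_le_pow_left₀ (by positivity) h3 2
        calc w ^ 4 * (1 + b) * (1 + b ^ 2) ≤ w ^ 4 * (3 / 2 * (1 + b ^ 2)) * (1 + b ^ 2) := by
              gcongr
          _ = 3 / 2 * (w ^ 2 * (1 + b ^ 2)) ^ 2 := by ring
          _ ≤ 3 / 2 * (13 * (n : ℝ) ^ 2) ^ 2 := by gcongr
          _ = _ := by ring
    rw [intervalIntegral.integral_const_mul] at hmono
    refine hmono.trans ?_
    have := integral_lorentzian_le_pi (n := n) x₀
    have hpi : ∫ x in (-1 : ℝ)..1, (n : ℝ) / (1 + (n * (x₀ - x)) ^ 2) ≤ 3.15 :=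
      this.trans Real.pi_lt_d2.le
    nlinarith
  have hZ0 : 0 < Z := by linarith
  refine ⟨Polynomial.C Z⁻¹ * K, ?_, ?_, ?_, ?_, ?_⟩
  · refine (Polynomial.natDegree_C_mul_le _ _).trans ?_
    refine Polynomial.natDegree_pow_le.trans ?_
    have := natDegree_sinRatioPoly_le hVdeg n
    omega
  · intro d
    have h := (((CoeffBound.const Z⁻¹).mul ((coeffBound_sinRatioPoly hVcoeff n).pow 4)).mono
      (B' := 7 ^ (4 * n)) ?_).sum_abs_coeff_le d
    · exact h
    · rw [abs_of_pos (by positivity), ← pow_mul, mul_comm n 4]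
      exact mul_le_of_le_one_left (by positivity) (inv_le_one_of_one_le₀ hZ1)
  · intro x
    rw [Polynomial.eval_C_mul]
    exact mul_nonneg (by positivity) (hK0 x)
  · simp only [Polynomial.eval_C_mul]
    rw [intervalIntegral.integral_const_mul, ← hZ, inv_mul_cancel₀ hZ0.ne']
  · simp only [Polynomial.eval_C_mul, mul_assoc]
    rw [intervalIntegral.integral_const_mul, inv_mul_le_iff₀ hZ0]
    refine hup.trans ?_
    linarith

/-! ### From line integrals to moments -/

/-- The integral of `F` over the graph of `x ↦ ξ x + η`. -/
noncomputable def lineIntegral (F : ℝ × ℝ → ℂ) (ξ η : ℝ) : ℂ := ∫ x, F (x, ξ * x + η)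

/-- A box containing the part of the parabolic region met by the lines under consideration. -/
def parabolaBox : Set (ℝ × ℝ) := Icc (-2) 2 ×ˢ Icc (-1) 2

lemma isCompact_parabolaBox : IsCompact parabolaBox := isCompact_Icc.prod isCompact_Icc

lemma volume_real_parabolaBox : volume.real parabolaBox = 12 := by
  rw [parabolaBox, Measure.volume_eq_prod, measureReal_prod_prod]
  norm_num

section

variable {F : ℝ × ℝ → ℂ}

/-- For bounded slope and intercept, `x²` exceeds `ξ x + η` outside a fixed interval, so locally
this is an integral over a compact set. -/
lemma continuous_lineIntegral (hF : Continuous F) (hsupp : ∀ x y, y < x ^ 2 → F (x, y) = 0) :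
    Continuous fun q : ℝ × ℝ => lineIntegral F q.1 q.2 := by
  refine continuous_iff_continuousAt.mpr fun q₀ => ?_
  set R : ℝ := ‖q₀‖ + 1 with hR
  have hR1 : 1 ≤ R := by linarith [norm_nonneg q₀]
  have hc : Continuous fun q : ℝ × ℝ => ∫ x in Icc (-(R + 1)) (R + 1), F (x, q.1 * x + q.2) :=
    continuous_parametric_integral_of_continuous
      (f := fun (q : ℝ × ℝ) (x : ℝ) => F (x, q.1 * x + q.2))
      (by simp only [Function.uncurry_def]; fun_prop) isCompact_Icc
  refine hc.continuousAt.congr ?_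
  have hball : Metric.ball q₀ 1 ∈ nhds q₀ := Metric.ball_mem_nhds _ one_pos
  filter_upwards [hball] with q hq
  refine setIntegral_eq_integral_of_forall_compl_eq_zero fun x hx => hsupp _ _ ?_
  have hq' : ‖q‖ ≤ R := by
    have h1 : ‖q - q₀‖ < 1 := by simpa [dist_eq_norm] using hq
    have h2 := norm_le_norm_add_norm_sub' q q₀
    linarith
  have h1 : |q.1| ≤ R := (norm_fst_le q).trans hq'
  have h2 : |q.2| ≤ R := (norm_snd_le q).trans hq'
  have hx' : R + 1 < |x| := by
    by_contra! h
    exact hx (abs_le.mp h)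
  have h3 : q.1 * x ≤ R * |x| := by
    refine (le_abs_self _).trans ?_
    rw [abs_mul]
    gcongr
  have h4 : q.2 ≤ R := (le_abs_self _).trans h2
  rw [← sq_abs]
  nlinarith

lemma mem_parabolaBox_of_le {x y ξ b : ℝ} (hξ : |ξ| ≤ 1 / 4) (hb : b ≤ 1) (h1 : x ^ 2 ≤ y)
    (h2 : y < b + ξ * x) : (x, y) ∈ parabolaBox := by
  have h3 : ξ * x ≤ 1 / 4 * |x| := by
    refine (le_abs_self _).trans ?_
    rw [abs_mul]
    gcongr
  have h4 : |x| ≤ 2 := by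
    by_contra! h
    rw [← sq_abs] at h1
    nlinarith
  refine ⟨abs_le.mp h4, ?_, ?_⟩ <;> simp only <;> nlinarith

lemma mul_truncPow_eq_zero_of_notMem (hsupp : ∀ x y, y < x ^ 2 → F (x, y) = 0) {γ' ξ : ℝ} {m : ℕ}
    (hm : m ≠ 0) (hξ : |ξ| ≤ 1 / 4) (hγ' : γ' ≤ 1) {q : ℝ × ℝ} (hq : q ∉ parabolaBox) :
    F q * (truncPow m (γ' - q.2 + ξ * q.1) : ℂ) = 0 := by
  obtain ⟨x, y⟩ := q
  by_cases h1 : y < x ^ 2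
  · rw [hsupp x y h1, zero_mul]
  · have h2 : ¬ y < γ' + ξ * x := fun h2 => hq (mem_parabolaBox_of_le hξ hγ' (not_lt.mp h1) h2)
    rw [truncPow_of_nonpos hm (by simp only; linarith)]
    simp

/-- Truncated-power moments of the line integrals are integrals of `F` against ridge functions. -/
lemma integral_truncPow_mul_lineIntegral (hF : Continuous F)
    (hsupp : ∀ x y, y < x ^ 2 → F (x, y) = 0) {γ' ξ : ℝ} {m : ℕ}
    (hm : m ≠ 0) (hξ : |ξ| ≤ 1 / 4) (hγ' : γ' ≤ 1) :
    ∫ η, (truncPow m (γ' - η) : ℂ) * lineIntegral F ξ η =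
      ∫ q in parabolaBox, F q * (truncPow m (γ' - q.2 + ξ * q.1) : ℂ) := by
  have htp := continuous_truncPow m
  set G : ℝ → ℝ → ℂ := fun η x => (truncPow m (γ' - η) : ℂ) * F (x, ξ * x + η) with hG
  have hGc : Continuous (Function.uncurry G) := by
    simp only [hG, Function.uncurry_def]; fun_prop
  have hGs : HasCompactSupport (Function.uncurry G) := by
    refine HasCompactSupport.intro (K := Icc (-4) 4 ×ˢ Icc (-2) 2)
      (isCompact_Icc.prod isCompact_Icc) fun q hq => ?_
    obtain ⟨η, x⟩ := q
    by_contra hne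
    simp only [hG, Function.uncurry_apply_pair] at hne
    have h1 := right_ne_zero_of_mul hne
    have h2 := left_ne_zero_of_mul hne
    have h1' : x ^ 2 ≤ ξ * x + η := not_lt.mp fun h => h1 (hsupp _ _ h)
    have h2' : η < γ' := not_le.mp fun h => h2 (by
      rw [truncPow_of_nonpos hm (by linarith)]; simp)
    have hbox := mem_parabolaBox_of_le (b := γ') hξ hγ' h1' (by linarith)
    refine hq ⟨?_, hbox.1⟩
    have hx : |x| ≤ 2 := abs_le.mpr hbox.1
    have hξx : |ξ * x| ≤ 1 := by
      rw [abs_mul]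
      nlinarith [abs_nonneg ξ, abs_nonneg x]
    have := abs_le.mp hξx
    constructor <;> simp only <;> nlinarith
  have hH : Continuous fun q : ℝ × ℝ => F q * (truncPow m (γ' - q.2 + ξ * q.1) : ℂ) := by fun_prop
  have hHi : Integrable (fun q : ℝ × ℝ => F q * (truncPow m (γ' - q.2 + ξ * q.1) : ℂ))
      (volume.prod volume) :=
    hH.integrable_of_hasCompactSupport (HasCompactSupport.intro isCompact_parabolaBox
      fun q hq => mul_truncPow_eq_zero_of_notMem hsupp hm hξ hγ' hq)
  rw [setIntegral_eq_integral_of_forall_compl_eq_zero fun q hq =>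
    mul_truncPow_eq_zero_of_notMem hsupp hm hξ hγ' hq, Measure.volume_eq_prod, integral_prod _ hHi]
  have h1 : ∀ η, (truncPow m (γ' - η) : ℂ) * lineIntegral F ξ η = ∫ x, G η x := fun η =>
    (integral_const_mul _ _).symm
  simp_rw [h1]
  rw [integral_integral_swap_of_hasCompactSupport hGc hGs]
  congr 1
  funext x
  -- For fixed `x`, the translation `η = y - ξ x` turns the line coordinate into the ordinate.
  rw [← integral_sub_right_eq_self _ (ξ * x)]
  congr 1
  funext y
  simp only [hG]
  rw [add_sub_cancel, mul_comm, sub_sub_eq_add_sub, add_sub_right_comm]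

/-- Completing the square, `x² - ξ x ≥ -ξ²/4 > -γ ≥ η`. -/
lemma lineIntegral_eq_zero (hsupp : ∀ x y, y < x ^ 2 → F (x, y) = 0) {ξ η γ : ℝ}
    (hξ : ξ ^ 2 < 4 * γ) (hη : η ≤ -γ) : lineIntegral F ξ η = 0 := by
  rw [lineIntegral, integral_eq_zero_of_ae]
  refine Filter.Eventually.of_forall fun x => hsupp _ _ ?_
  nlinarith [sq_nonneg (x - ξ / 2)]

lemma norm_integral_ridge_le (hF : Continuous F)
    (hsupp : ∀ x y, y < x ^ 2 → F (x, y) = 0) {γ γ' ξ : ℝ} {m : ℕ}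
    (hm : m ≠ 0) (hξ : |ξ| ≤ 1 / 4) (hξγ : ξ ^ 2 < 4 * γ) (hγ : γ ≤ 1) (hγ' : γ' ≤ γ) {D : ℝ}
    (hD0 : 0 ≤ D)
    (hD : ∫⁻ η in Ioo (-γ) γ, ‖lineIntegral F ξ η‖ₑ ≤ ENNReal.ofReal D) :
    ‖∫ q in parabolaBox, F q * (truncPow m (γ' - q.2 + ξ * q.1) : ℂ)‖ ≤ 2 ^ m * D := by
  rw [← integral_truncPow_mul_lineIntegral hF hsupp hm hξ (hγ'.trans hγ)]
  have hzero : ∀ η ∉ Ioo (-γ) γ, (truncPow m (γ' - η) : ℂ) * lineIntegral F ξ η = 0 := by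
    intro η hη
    by_cases h1 : η ≤ -γ
    · rw [lineIntegral_eq_zero hsupp hξγ h1, mul_zero]
    · have h2 : γ ≤ η := not_lt.mp fun h2 => hη ⟨not_le.mp h1, h2⟩
      rw [truncPow_of_nonpos hm (by linarith)]
      simp
  rw [← setIntegral_eq_integral_of_forall_compl_eq_zero hzero]
  have h1 := enorm_integral_le_lintegral_enorm (μ := volume.restrict (Ioo (-γ) γ))
    (fun η => (truncPow m (γ' - η) : ℂ) * lineIntegral F ξ η)
  have h2 : ∫⁻ η in Ioo (-γ) γ, ‖(truncPow m (γ' - η) : ℂ) * lineIntegral F ξ η‖ₑ ≤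
      ∫⁻ η in Ioo (-γ) γ, ENNReal.ofReal (2 ^ m) * ‖lineIntegral F ξ η‖ₑ := by
    refine setLIntegral_mono' measurableSet_Ioo fun η hη => ?_
    rw [enorm_mul]
    gcongr
    rw [← ofReal_norm, Complex.norm_real, Real.norm_of_nonneg (truncPow_nonneg _ _)]
    exact ENNReal.ofReal_le_ofReal (truncPow_le_two_pow m (by linarith [hη.1]))
  rw [lintegral_const_mul' _ _ ENNReal.ofReal_ne_top] at h2
  have h3 := (h1.trans h2).trans (mul_le_mul_right hD _)
  rw [← ENNReal.ofReal_mul (by positivity), ← ofReal_norm] at h3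
  exact (ENNReal.ofReal_le_ofReal_iff (by positivity)).mp h3

/-- The constant `24` is the factor `2` of the Taylor remainder times the area `12` of the box; `2 *
ρ` bounds `|ξ x|` there. -/
lemma norm_taylor_ridge_le (hF : Continuous F) {B : ℝ} (hB : ∀ q ∈ parabolaBox, ‖F q‖ ≤ B)
    {ξ ρ : ℝ} (hξ : |ξ| ≤ ρ) (γ' : ℝ) {m : ℕ} (hm : m ≠ 0) :
    ‖∑ i ∈ Finset.range m, ((ξ ^ i / (i.factorial : ℝ) : ℝ) : ℂ) *
      ∫ q in parabolaBox, F q * ((q.1 ^ i * truncPow (m - i) (γ' - q.2) : ℝ) : ℂ)‖ ≤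
    ‖∫ q in parabolaBox, F q * (truncPow m (γ' - q.2 + ξ * q.1) : ℂ)‖ + 24 * B * (2 * ρ) ^ m := by
  have htp := fun i => continuous_truncPow i
  have hint : ∀ h : ℝ × ℝ → ℂ, Continuous h → IntegrableOn h parabolaBox volume :=
    fun h hh => hh.continuousOn.integrableOn_compact isCompact_parabolaBox
  have hsum : ∑ i ∈ Finset.range m, ((ξ ^ i / (i.factorial : ℝ) : ℝ) : ℂ) *
      ∫ q in parabolaBox, F q * ((q.1 ^ i * truncPow (m - i) (γ' - q.2) : ℝ) : ℂ) =
      ∫ q in parabolaBox, F q * ((∑ i ∈ Finset.range m, (ξ * q.1) ^ i / (i.factorial : ℝ) *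
        truncPow (m - i) (γ' - q.2) : ℝ) : ℂ) := by
    simp_rw [← integral_const_mul]
    rw [← integral_finsetSum _ fun i _ => hint _ (by have := htp (m - i); fun_prop)]
    congr 1
    funext q
    push_cast
    rw [Finset.mul_sum]
    refine Finset.sum_congr rfl fun i _ => ?_
    rw [mul_pow]
    ring
  have hdiff : (∫ q in parabolaBox, F q * (truncPow m (γ' - q.2 + ξ * q.1) : ℂ)) -
      (∫ q in parabolaBox, F q * ((∑ i ∈ Finset.range m, (ξ * q.1) ^ i / (i.factorial : ℝ) *
        truncPow (m - i) (γ' - q.2) : ℝ) : ℂ)) =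
      ∫ q in parabolaBox, F q * ((truncPow m (γ' - q.2 + ξ * q.1) -
        ∑ i ∈ Finset.range m, (ξ * q.1) ^ i / (i.factorial : ℝ) *
          truncPow (m - i) (γ' - q.2) : ℝ) : ℂ) := by
    rw [← integral_sub (hint _ (by have := htp m; fun_prop)) (hint _ (by fun_prop))]
    congr 1
    funext q
    push_cast
    ring
  have hbd : ‖∫ q in parabolaBox, F q * ((truncPow m (γ' - q.2 + ξ * q.1) -
        ∑ i ∈ Finset.range m, (ξ * q.1) ^ i / (i.factorial : ℝ) *
          truncPow (m - i) (γ' - q.2) : ℝ) : ℂ)‖ ≤ (B * (2 * (2 * ρ) ^ m)) * 12 := by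
    rw [← volume_real_parabolaBox]
    refine norm_setIntegral_le_of_norm_le_const isCompact_parabolaBox.measure_lt_top fun q hq => ?_
    rw [norm_mul, Complex.norm_real, Real.norm_eq_abs]
    refine mul_le_mul (hB q hq) ?_ (abs_nonneg _) ((norm_nonneg _).trans (hB q hq))
    refine (abs_truncPow_add_sub_sum_le hm _ _).trans ?_
    refine (div_le_self (by positivity) (by exact_mod_cast Nat.factorial_pos m)).trans ?_
    gcongr
    rw [abs_mul, mul_comm]
    exact mul_le_mul (abs_le.mpr hq.1) hξ (abs_nonneg _) zero_le_two
  rw [hsum]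
  have htri := norm_sub_norm_le (∫ q in parabolaBox, F q * ((∑ i ∈ Finset.range m,
    (ξ * q.1) ^ i / (i.factorial : ℝ) * truncPow (m - i) (γ' - q.2) : ℝ) : ℂ))
    (∫ q in parabolaBox, F q * (truncPow m (γ' - q.2 + ξ * q.1) : ℂ))
  rw [norm_sub_rev, hdiff] at htri
  linarith

/-- Moments of `F` against `xᵏ` and a truncated power in `y` are controlled by the line integrals
with slopes in `[0, ρ]`. -/
lemma norm_moment_le (hF : Continuous F)
    (hsupp : ∀ x y, y < x ^ 2 → F (x, y) = 0) {B : ℝ} (hB : ∀ q ∈ parabolaBox, ‖F q‖ ≤ B)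
    {γ γ' ρ D : ℝ} (hγ1 : γ ≤ 1) (hγ' : γ' ≤ γ) (hρ0 : 0 < ρ) (hρ : ρ ≤ 1 / 4)
    (hργ : ρ ≤ γ) (hD0 : 0 ≤ D)
    (hD : ∀ a b, 0 ≤ a → a < b → b ≤ ρ → ∃ ξ ∈ Icc a b,
      ∫⁻ η in Ioo (-γ) γ, ‖lineIntegral F ξ η‖ₑ ≤ ENNReal.ofReal (D / (b - a)))
    {j : ℕ} (hj : j ≠ 0) (k : ℕ) {m : ℕ} (hm : m = j + k) :
    ‖∫ q in parabolaBox, F q * ((q.1 ^ k * truncPow j (γ' - q.2) : ℝ) : ℂ)‖ ≤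
      (k.factorial : ℝ) * (ρ ^ k)⁻¹ *
        (m * ((2 ^ m * (D / (ρ / (2 * m))) + 24 * B * (2 * ρ) ^ m) * (2 / (1 / (2 * m))) ^ (m - 1))) := by
  have hm0 : m ≠ 0 := by omega
  have hmpos : (0 : ℝ) < m := by exact_mod_cast Nat.pos_of_ne_zero hm0
  set A : ℕ → ℂ := fun i =>
    ∫ q in parabolaBox, F q * ((q.1 ^ i * truncPow (m - i) (γ' - q.2) : ℝ) : ℂ) with hA
  -- The substitution `ξ = ρ z` moves the nodes to `[0, 1]`; undoing it costs `k! ρ⁻ᵏ` in the `k`-th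
  -- coefficient.
  set Q : Polynomial ℂ := ∑ i ∈ Finset.range m,
    Polynomial.monomial i (((ρ ^ i / (i.factorial : ℝ) : ℝ) : ℂ) * A i) with hQ
  have hcoeff : ∀ i, Q.coeff i =
      if i < m then ((ρ ^ i / (i.factorial : ℝ) : ℝ) : ℂ) * A i else 0 := by
    intro i
    simp [hQ, Polynomial.finsetSum_coeff, Polynomial.coeff_monomial]
  have hdeg : Q.degree < m := by
    rw [Polynomial.degree_lt_iff_coeff_zero]
    intro i hi
    rw [hcoeff, if_neg (not_lt.mpr hi)]
  -- Each node is sought in the left half of its cell `[l/m, (l+1)/m]`; the empty right halves keep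
  -- distinct nodes `1/(2m)` apart.
  have hnode : ∀ l : ℕ, ∃ z : ℝ, l < m → (z ∈ Icc ((l : ℝ) / m) (l / m + 1 / (2 * m)) ∧
      ∫⁻ η in Ioo (-γ) γ, ‖lineIntegral F (ρ * z) η‖ₑ ≤
        ENNReal.ofReal (D / (ρ / (2 * m)))) := by
    intro l
    by_cases hl : l < m
    · have hl' : (l : ℝ) + 1 ≤ m := by exact_mod_cast hl
      have hend : (l : ℝ) / m + 1 / (2 * m) ≤ 1 := by
        rw [div_add_div _ _ hmpos.ne' (by positivity), div_le_one (by positivity)]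
        nlinarith
      obtain ⟨ξ, hξ, hξD⟩ := hD (ρ * (l / m)) (ρ * (l / m + 1 / (2 * m))) (by positivity)
        (by gcongr; linarith [show (0 : ℝ) < 1 / (2 * m) by positivity])
        (by nlinarith)
      refine ⟨ξ / ρ, fun _ => ⟨⟨?_, ?_⟩, ?_⟩⟩
      · rw [le_div_iff₀ hρ0]; linarith [hξ.1]
      · rw [div_le_iff₀ hρ0]; linarith [hξ.2]
      · rw [mul_div_cancel₀ _ hρ0.ne']
        convert hξD using 3
        field_simp
        ring
    · exact ⟨0, fun h => absurd h hl⟩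
  choose z hz using hnode
  have hz01 : ∀ l < m, 0 ≤ z l ∧ z l ≤ 1 := by
    intro l hl
    have hl' : (l : ℝ) + 1 ≤ m := by exact_mod_cast hl
    obtain ⟨h1, h2⟩ := (hz l hl).1
    refine ⟨le_trans (by positivity) h1, h2.trans ?_⟩
    rw [div_add_div _ _ hmpos.ne' (by positivity), div_le_one (by positivity)]
    nlinarith
  have hsep : ∀ i j, i < m → j < m → i < j → 1 / (2 * (m : ℝ)) ≤ z j - z i := by
    intro i j hi hj hij
    have h1 := (hz i hi).1.2
    have h2 := (hz j hj).1.1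
    have hij' : (i : ℝ) + 1 ≤ j := by exact_mod_cast hij
    have h3 : ((i : ℝ) + 1) / m ≤ j / m := by gcongr
    have h4 : ((i : ℝ) + 1) / m = i / m + 2 * (1 / (2 * m)) := by field_simp
    linarith
  have hbound := norm_coeff_le_of_norm_eval_le hdeg z (s := 1 / (2 * m))
    (A := 2 ^ m * (D / (ρ / (2 * m))) + 24 * B * (2 * ρ) ^ m) (by positivity)
    (fun i hi j hj hij => by
      rcases lt_or_gt_of_ne hij with h | h
      · rw [abs_sub_comm]; exact (hsep i j hi hj h).trans (le_abs_self _)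
      · exact (hsep j i hj hi h).trans (le_abs_self _))
    (fun i hi => abs_le.mpr ⟨by linarith [(hz01 i hi).1], (hz01 i hi).2⟩)
    (fun i hi => by
      obtain ⟨h0, h1⟩ := hz01 i hi
      have hξ : |ρ * z i| ≤ ρ := by
        rw [abs_of_nonneg (by positivity)]; nlinarith
      have hev : Q.eval (z i : ℂ) = ∑ l ∈ Finset.range m,
          (((ρ * z i) ^ l / (l.factorial : ℝ) : ℝ) : ℂ) * A l := by
        rw [hQ, Polynomial.eval_finsetSum]
        refine Finset.sum_congr rfl fun l _ => ?_
        rw [Polynomial.eval_monomial]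
        push_cast
        ring
      rw [hev]
      refine (norm_taylor_ridge_le hF hB hξ γ' hm0).trans ?_
      gcongr
      refine norm_integral_ridge_le hF hsupp hm0 (hξ.trans hρ) ?_ hγ1 hγ' (by positivity) (hz i hi).2
      have := abs_le.mp hξ
      nlinarith) k
  rw [hcoeff, if_pos (by omega), norm_mul, Complex.norm_real, Real.norm_of_nonneg (by positivity)]
    at hbound
  have hAk : A k = ∫ q in parabolaBox, F q * ((q.1 ^ k * truncPow j (γ' - q.2) : ℝ) : ℂ) := by
    rw [hA]; simp only [show m - k = j by omega]
  rw [← hAk]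
  have hk : (0 : ℝ) < k.factorial := by exact_mod_cast k.factorial_pos
  calc ‖A k‖ = (k.factorial : ℝ) * (ρ ^ k)⁻¹ * (ρ ^ k / (k.factorial : ℝ) * ‖A k‖) := by
        field_simp
    _ ≤ _ := by gcongr

end

/-! ### From moments to point values -/

section

variable {F : ℝ × ℝ → ℂ}

/-- After scaling out `1/n`, the base `1 + n s` is at least `1`, so the exponent can be raised from
`α` to `1`. This produces the weight integrated against the Jackson polynomial. -/
lemma add_inv_rpow_le {n : ℕ} (hn : n ≠ 0) {α : ℝ} (hα0 : 0 ≤ α) (hα1 : α ≤ 1) {d s : ℝ} (hs : 0 ≤ s)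
    (hd0 : 0 ≤ d) (hd : d ≤ s + 1 / n) : d ^ α ≤ (n : ℝ) ^ (-α) * (1 + n * s) := by
  have hn' : (0 : ℝ) < n := by exact_mod_cast Nat.pos_of_ne_zero hn
  have h1 : (1 : ℝ) ≤ 1 + n * s := by nlinarith
  have h2 : s + 1 / n = (n : ℝ)⁻¹ * (1 + n * s) := by field_simp; ring
  calc d ^ α ≤ ((n : ℝ)⁻¹ * (1 + n * s)) ^ α := Real.rpow_le_rpow hd0 (h2 ▸ hd) hα0
    _ = (n : ℝ) ^ (-α) * (1 + n * s) ^ α := by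
      rw [Real.mul_rpow (by positivity) (by positivity), Real.inv_rpow hn'.le, Real.rpow_neg hn'.le]
    _ ≤ (n : ℝ) ^ (-α) * (1 + n * s) ^ (1 : ℝ) := by
      gcongr
    _ = _ := by rw [Real.rpow_one]

lemma continuous_polynomialMoment (hF : Continuous F) (p : Polynomial ℝ) :
    Continuous fun y => ∫ x in (-2 : ℝ)..2, F (x, y) * ((p.eval x : ℝ) : ℂ) := by
  refine intervalIntegral.continuous_parametric_intervalIntegral_of_continuous'
    (f := fun y x => F (x, y) * ((p.eval x : ℝ) : ℂ)) ?_ _ _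
  have := p.continuous
  simp only [Function.uncurry_def]
  fun_prop

/-- Since `p` has mass one, the difference is a `p`-average of `F (x, y) - F (x₀, γ)`; only `[-1,
1]` matters because `x² ≤ y ≤ γ < 1` on the support. -/
lemma norm_polynomialMoment_sub_le (hF : Continuous F) (hsupp : ∀ x y, y < x ^ 2 → F (x, y) = 0)
    {C₀ α γ : ℝ} (hα0 : 0 ≤ α) (hα1 : α ≤ 1) (hC₀ : 0 ≤ C₀)
    (hH : ∀ x y x' y', ‖F (x, y) - F (x', y')‖ ≤ C₀ * (|x - x'| + |y - y'|) ^ α)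
    (hγ : γ < 1) {n : ℕ} (hn : n ≠ 0) {x₀ : ℝ} {p : Polynomial ℝ} (hp0 : ∀ x, 0 ≤ p.eval x)
    (hp1 : ∫ x in (-1 : ℝ)..1, p.eval x = 1)
    (hp2 : ∫ x in (-1 : ℝ)..1, p.eval x * (1 + n * |x₀ - x|) ≤ 1600)
    {y : ℝ} (hy : y ∈ Icc (γ - 1 / n) γ) :
    ‖(∫ x in (-2 : ℝ)..2, F (x, y) * ((p.eval x : ℝ) : ℂ)) - F (x₀, γ)‖ ≤
      1600 * C₀ * (n : ℝ) ^ (-α) := by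
  have hpc := p.continuous
  have hrestrict : ∫ x in (-2 : ℝ)..2, F (x, y) * ((p.eval x : ℝ) : ℂ) =
      ∫ x in (-1 : ℝ)..1, F (x, y) * ((p.eval x : ℝ) : ℂ) := by
    have hs : Function.support (fun x => F (x, y) * ((p.eval x : ℝ) : ℂ)) ⊆ Ioc (-1) 1 := by
      intro x hx
      have h1 := left_ne_zero_of_mul hx
      have h2 : x ^ 2 ≤ y := not_lt.mp fun h => h1 (hsupp _ _ h)
      have h3 := hy.2
      constructor <;> nlinarith
    rw [intervalIntegral.integral_eq_integral_of_support_subset hs,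
      intervalIntegral.integral_eq_integral_of_support_subset
        (hs.trans (Ioc_subset_Ioc (by norm_num) (by norm_num)))]
  have hconst : F (x₀, γ) = ∫ x in (-1 : ℝ)..1, F (x₀, γ) * ((p.eval x : ℝ) : ℂ) := by
    rw [intervalIntegral.integral_const_mul, intervalIntegral.integral_ofReal, hp1]
    simp
  rw [hrestrict, hconst, ← intervalIntegral.integral_sub
    (Continuous.intervalIntegrable (by fun_prop) _ _)
    (Continuous.intervalIntegrable (by fun_prop) _ _)]
  calc ‖∫ x in (-1 : ℝ)..1, (F (x, y) * ((p.eval x : ℝ) : ℂ) - F (x₀, γ) * ((p.eval x : ℝ) : ℂ))‖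
      ≤ ∫ x in (-1 : ℝ)..1, C₀ * (n : ℝ) ^ (-α) * (p.eval x * (1 + n * |x₀ - x|)) := by
        refine intervalIntegral.norm_integral_le_of_norm_le (by norm_num)
          (Filter.Eventually.of_forall fun x _ => ?_)
          (Continuous.intervalIntegrable (by fun_prop) _ _)
        rw [← sub_mul, norm_mul, Complex.norm_real, Real.norm_of_nonneg (hp0 x)]
        have h1 := hH x y x₀ γ
        have h2 : |y - γ| ≤ 1 / n := by
          have := hy.1
          rw [abs_of_nonpos (by linarith [hy.2])]
          linarith
        have h3 := add_inv_rpow_le hn hα0 hα1 (abs_nonneg (x₀ - x))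
          (by positivity : 0 ≤ |x - x₀| + |y - γ|) (by rw [abs_sub_comm x₀ x]; linarith)
        calc _ ≤ C₀ * ((n : ℝ) ^ (-α) * (1 + n * |x₀ - x|)) * p.eval x := by
              gcongr
              · exact hp0 x
              · exact h1.trans (by gcongr)
          _ = _ := by ring
    _ = C₀ * (n : ℝ) ^ (-α) * ∫ x in (-1 : ℝ)..1, p.eval x * (1 + n * |x₀ - x|) :=
        intervalIntegral.integral_const_mul _ _
    _ ≤ C₀ * (n : ℝ) ^ (-α) * 1600 := by gcongr
    _ = _ := by ring

/-- Cauchy's formula and Fubini on the box, after expanding `p` in monomials: the antiderivatives to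
be differenced are combinations of the moments already controlled. -/
lemma iterIntegral_polynomialMoment (hF : Continuous F) (p : Polynomial ℝ) {y : ℝ}
    (hy : y ∈ Icc (-1 : ℝ) 2) {j : ℕ} (hj : j ≠ 0) :
    iterIntegral (-1) (fun y => ∫ x in (-2 : ℝ)..2, F (x, y) * ((p.eval x : ℝ) : ℂ)) (j + 1) y =
      ∑ k ∈ Finset.range (p.natDegree + 1), (p.coeff k : ℂ) *
        ∫ q in parabolaBox, F q * ((q.1 ^ k * truncPow j (y - q.2) : ℝ) : ℂ) := by
  have htp := continuous_truncPow j
  have hpc := p.continuous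
  have hint : ∀ h : ℝ × ℝ → ℂ, Continuous h → IntegrableOn h parabolaBox volume :=
    fun h hh => hh.continuousOn.integrableOn_compact isCompact_parabolaBox
  rw [iterIntegral_eq_truncPow (continuous_polynomialMoment hF p) hy hj]
  simp_rw [← integral_const_mul]
  rw [← integral_finsetSum _ fun i _ => hint _ (by fun_prop)]
  have hpt : ∀ q : ℝ × ℝ, ∑ k ∈ Finset.range (p.natDegree + 1), (p.coeff k : ℂ) *
      (F q * ((q.1 ^ k * truncPow j (y - q.2) : ℝ) : ℂ)) =
      (truncPow j (y - q.2) : ℂ) * (F q * ((p.eval q.1 : ℝ) : ℂ)) := by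
    intro q
    rw [Polynomial.eval_eq_sum_range]
    push_cast
    rw [Finset.mul_sum, Finset.mul_sum]
    exact Finset.sum_congr rfl fun k _ => by ring
  simp_rw [hpt]
  have hi : IntegrableOn (fun q : ℝ × ℝ => (truncPow j (y - q.2) : ℂ) * (F q * ((p.eval q.1 : ℝ) : ℂ)))
      parabolaBox volume := hint _ (by fun_prop)
  rw [parabolaBox, Measure.volume_eq_prod] at hi ⊢
  rw [IntegrableOn, ← Measure.prod_restrict] at hi
  rw [← Measure.prod_restrict, integral_prod_symm _ hi,
    intervalIntegral.integral_of_le (by norm_num), ← integral_Icc_eq_integral_Ioc]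
  congr 1
  funext u
  simp only
  rw [integral_const_mul, intervalIntegral.integral_of_le (by norm_num),
    ← integral_Icc_eq_integral_Ioc]

lemma norm_le_of_moment_le (hF : Continuous F) (hsupp : ∀ x y, y < x ^ 2 → F (x, y) = 0)
    {C₀ α γ : ℝ} (hα0 : 0 ≤ α) (hα1 : α ≤ 1) (hC₀ : 0 ≤ C₀)
    (hH : ∀ x y x' y', ‖F (x, y) - F (x', y')‖ ≤ C₀ * (|x - x'| + |y - y'|) ^ α)
    (hγ0 : 0 < γ) (hγ : γ < 1) {n : ℕ} (hn : 2 ≤ n) {E : ℝ}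
    (hE : ∀ k ≤ 8 * n, ∀ γ' ≤ γ,
      ‖∫ q in parabolaBox, F q * ((q.1 ^ k * truncPow (n - 1) (γ' - q.2) : ℝ) : ℂ)‖ ≤ E)
    {x₀ : ℝ} (hx₀ : x₀ ∈ Icc (-1 : ℝ) 1) :
    ‖F (x₀, γ)‖ ≤ 1600 * C₀ * (n : ℝ) ^ (-α) + (2 * (n : ℝ) ^ 2) ^ n * (7 ^ (4 * n) * E) := by
  obtain ⟨p, hdeg, hcoeff, hp0, hp1, hp2⟩ := exists_jackson_polynomial hn hx₀
  have hn' : (2 : ℝ) ≤ n := by exact_mod_cast hn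
  -- The `n` averages together look back by `n t = 1/n`, the resolution of `p`.
  set t : ℝ := 1 / (n : ℝ) ^ 2 with ht
  have ht0 : 0 < t := by positivity
  have hnt : (n : ℝ) * t = 1 / n := by rw [ht]; field_simp
  have hn1 : (1 : ℝ) / n ≤ 1 := by rw [div_le_one (by linarith)]; linarith
  set a : ℝ → ℂ := fun y => ∫ x in (-2 : ℝ)..2, F (x, y) * ((p.eval x : ℝ) : ℂ) with ha
  have hac : Continuous a := continuous_polynomialMoment hF p
  have h1 := norm_iterate_backAvg_sub_le ht0 n γ (F (x₀, γ)) hac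
    (e := 1600 * C₀ * (n : ℝ) ^ (-α)) fun y hy =>
      norm_polynomialMoment_sub_le hF hsupp hα0 hα1 hC₀ hH hγ (by omega) hp0 hp1 hp2 (hnt ▸ hy)
  have h2 := norm_iterate_backAvg_le ht0 n γ (E := 7 ^ (4 * n) * E) (iterIntegral (-1) a) hac
    (fun j y => hasDerivAt_integral_of_continuous (continuous_iterIntegral hac (-1) j) (-1) y)
    fun y hy => by
      rw [hnt] at hy
      obtain ⟨j, rfl⟩ : ∃ j, n = j + 1 := ⟨n - 1, by omega⟩
      rw [ha, iterIntegral_polynomialMoment hF p ⟨by linarith [hy.1], by linarith [hy.2]⟩ (by omega)]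
      refine (norm_sum_le _ _).trans ?_
      have hE0 : 0 ≤ E := (norm_nonneg _).trans (hE 0 (by omega) γ le_rfl)
      calc _ ≤ ∑ k ∈ Finset.range (p.natDegree + 1), |p.coeff k| * E := by
            refine Finset.sum_le_sum fun k hk => ?_
            rw [norm_mul, Complex.norm_real, Real.norm_eq_abs]
            gcongr
            have := Finset.mem_range.mp hk
            exact hE k (by omega) y hy.2
        _ = (∑ k ∈ Finset.range (p.natDegree + 1), |p.coeff k|) * E := by rw [Finset.sum_mul]
        _ ≤ _ := by
          gcongr
          exact hcoeff _
  have h3 : (2 / t : ℝ) = 2 * (n : ℝ) ^ 2 := by rw [ht]; field_simp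
  rw [h3] at h2
  have h4 := norm_sub_norm_le (F (x₀, γ)) ((backAvg t)^[n] a γ)
  rw [norm_sub_rev] at h4
  simp only [iterIntegral] at h2
  linarith

end

/-! ### Bookkeeping of powers of `n` -/

/-- The exponent `43` is `16 + 9 + 18`, from `k!`, `2ᵐ` and the interpolation; `ρ⁻ᵏ` with `k ≤ 8n`
adds `800n` to the data term, but in the remainder it cancels against `ρᵐ` and leaves `ρ^(n-1)`. -/
lemma moment_bound_le {n k m : ℕ} {B D ρ : ℝ} (hn : 2401 ≤ n) (hk : k ≤ 8 * n) (hm : m = n - 1 + k)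
    (hB0 : 0 ≤ B) (hB : 24 * B ≤ n) (hD0 : 0 ≤ D) (hρ : ρ = ((n : ℝ) ^ 100)⁻¹) :
    (k.factorial : ℝ) * (ρ ^ k)⁻¹ *
        (m * ((2 ^ m * (D / (ρ / (2 * m))) + 24 * B * (2 * ρ) ^ m) * (2 / (1 / (2 * m))) ^ (m - 1))) ≤
      D * (n : ℝ) ^ (843 * n + 104) + (n : ℝ) ^ (43 * n + 3) * ((n : ℝ) ^ (100 * (n - 1)))⁻¹ := by
  have hn' : (2401 : ℝ) ≤ n := by exact_mod_cast hn
  have hm9 : m ≤ 9 * n := by omega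
  have hm9' : (m : ℝ) ≤ 9 * n := by exact_mod_cast hm9
  have hm0 : m ≠ 0 := by omega
  have hmpos : (0 : ℝ) < m := by exact_mod_cast Nat.pos_of_ne_zero hm0
  have hn1 : (1 : ℝ) ≤ n := by linarith
  have e1 : (k.factorial : ℝ) ≤ (n : ℝ) ^ (16 * n) := by
    have h1 : (k.factorial : ℝ) ≤ (k : ℝ) ^ k := by exact_mod_cast Nat.factorial_le_pow k
    have h2 : (k : ℝ) ≤ (n : ℝ) ^ 2 := by
      have : (k : ℝ) ≤ 8 * n := by exact_mod_cast hk
      nlinarith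
    calc _ ≤ (k : ℝ) ^ k := h1
      _ ≤ ((n : ℝ) ^ 2) ^ k := by gcongr
      _ = (n : ℝ) ^ (2 * k) := by rw [pow_mul]
      _ ≤ _ := pow_le_pow_right₀ hn1 (by omega)
  have e2 : (ρ ^ k)⁻¹ = (n : ℝ) ^ (100 * k) := by rw [hρ, inv_pow, inv_inv, pow_mul]
  have e3 : (m : ℝ) ≤ (n : ℝ) ^ 2 := by nlinarith
  have e4 : (2 / (1 / (2 * (m : ℝ)))) ^ (m - 1) ≤ (n : ℝ) ^ (18 * n) := by
    have : 2 / (1 / (2 * (m : ℝ))) ≤ (n : ℝ) ^ 2 := by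
      rw [div_div_eq_mul_div, div_one]; nlinarith
    calc _ ≤ ((n : ℝ) ^ 2) ^ (m - 1) := by gcongr
      _ = (n : ℝ) ^ (2 * (m - 1)) := by rw [pow_mul]
      _ ≤ _ := pow_le_pow_right₀ hn1 (by omega)
  have e5 : (2 : ℝ) ^ m ≤ (n : ℝ) ^ (9 * n) :=
    calc (2 : ℝ) ^ m ≤ (n : ℝ) ^ m := by gcongr; linarith
      _ ≤ _ := pow_le_pow_right₀ hn1 hm9
  have e6 : D / (ρ / (2 * m)) ≤ D * (n : ℝ) ^ 102 := by
    have : D / (ρ / (2 * m)) = D * (2 * m * (n : ℝ) ^ 100) := by rw [hρ]; field_simp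
    rw [this]
    gcongr
    calc 2 * (m : ℝ) * (n : ℝ) ^ 100 ≤ (n : ℝ) ^ 2 * (n : ℝ) ^ 100 := by gcongr; nlinarith
      _ = _ := by rw [← pow_add]
  have e7 : (2 * ρ) ^ m = 2 ^ m * ((n : ℝ) ^ (100 * m))⁻¹ := by
    rw [hρ, mul_pow, inv_pow, ← pow_mul]
  have hρ0 : 0 < ρ := by rw [hρ]; positivity
  rw [e2, e7]
  calc _ ≤ (n : ℝ) ^ (16 * n) * (n : ℝ) ^ (100 * k) * ((n : ℝ) ^ 2 *
        (((n : ℝ) ^ (9 * n) * (D * (n : ℝ) ^ 102) +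
          n * ((n : ℝ) ^ (9 * n) * ((n : ℝ) ^ (100 * m))⁻¹)) * (n : ℝ) ^ (18 * n))) := by
        gcongr
    _ = D * (n : ℝ) ^ (43 * n + 100 * k + 104) +
        (n : ℝ) ^ (43 * n + 3) * ((n : ℝ) ^ (100 * k) * ((n : ℝ) ^ (100 * m))⁻¹) := by ring
    _ = D * (n : ℝ) ^ (43 * n + 100 * k + 104) +
        (n : ℝ) ^ (43 * n + 3) * ((n : ℝ) ^ (100 * (n - 1)))⁻¹ := by
        rw [show 100 * m = 100 * (n - 1) + 100 * k by omega, pow_add (n : ℝ) (100 * (n - 1)), mul_inv]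
        congr 2
        field_simp
    _ ≤ _ := by
        gcongr
        omega

lemma amplified_moment_bound_le {n : ℕ} {D : ℝ} (hn : 2401 ≤ n) (hD0 : 0 ≤ D)
    (hD : D * (n : ℝ) ^ (1000 * n) ≤ 1) :
    (2 * (n : ℝ) ^ 2) ^ n * (7 ^ (4 * n) * (D * (n : ℝ) ^ (843 * n + 104) +
      (n : ℝ) ^ (43 * n + 3) * ((n : ℝ) ^ (100 * (n - 1)))⁻¹)) ≤ 2 / n := by
  have hn' : (2401 : ℝ) ≤ n := by exact_mod_cast hn
  have hn1 : (1 : ℝ) ≤ n := by linarith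
  have hn0 : (0 : ℝ) < n := by linarith
  have e1 : (2 * (n : ℝ) ^ 2) ^ n ≤ (n : ℝ) ^ (3 * n) := by
    rw [pow_mul]
    gcongr
    nlinarith [sq_nonneg (n : ℝ)]
  -- The threshold `2401` is `7 ^ 4`.
  have e2 : (7 : ℝ) ^ (4 * n) ≤ (n : ℝ) ^ n := by
    rw [pow_mul]
    gcongr
    norm_num
    exact hn
  have t1 : D * (n : ℝ) ^ (847 * n + 104) ≤ 1 / n := by
    rw [le_div_iff₀ hn0, mul_assoc, ← pow_succ]
    refine le_trans ?_ hD
    gcongr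
    omega
  have t2 : (n : ℝ) ^ (47 * n + 3) * ((n : ℝ) ^ (100 * (n - 1)))⁻¹ ≤ 1 / n := by
    rw [le_div_iff₀ hn0, mul_right_comm, ← pow_succ, mul_inv_le_iff₀ (by positivity), one_mul]
    exact pow_le_pow_right₀ hn1 (by omega)
  calc _ ≤ (n : ℝ) ^ (3 * n) * ((n : ℝ) ^ n * (D * (n : ℝ) ^ (843 * n + 104) +
        (n : ℝ) ^ (43 * n + 3) * ((n : ℝ) ^ (100 * (n - 1)))⁻¹)) := by gcongr
    _ = D * (n : ℝ) ^ (847 * n + 104) +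
        (n : ℝ) ^ (47 * n + 3) * ((n : ℝ) ^ (100 * (n - 1)))⁻¹ := by ring
    _ ≤ 1 / n + 1 / n := add_le_add t1 t2
    _ = 2 / n := by ring

/-- The stability estimate at a given resolution `n`. -/
lemma norm_le_of_lineIntegral_le {F : ℝ × ℝ → ℂ} (hF : Continuous F)
    (hsupp : ∀ x y, y < x ^ 2 → F (x, y) = 0)
    {C₀ α B γ D : ℝ} (hα0 : 0 ≤ α) (hα1 : α ≤ 1) (hC₀ : 0 ≤ C₀)
    (hH : ∀ x y x' y', ‖F (x, y) - F (x', y')‖ ≤ C₀ * (|x - x'| + |y - y'|) ^ α)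
    (hB : ∀ q ∈ parabolaBox, ‖F q‖ ≤ B) (hγ : γ < 1) (hD0 : 0 ≤ D)
    {n : ℕ} (hn : 2401 ≤ n) (hnB : 24 * B ≤ n) (hnγ : ((n : ℝ))⁻¹ ≤ γ)
    (hDn : D * (n : ℝ) ^ (1000 * n) ≤ 1)
    (hD : ∀ a b, 0 ≤ a → a < b → b ≤ (n : ℝ)⁻¹ → ∃ ξ ∈ Icc a b,
      ∫⁻ η in Ioo (-γ) γ, ‖lineIntegral F ξ η‖ₑ ≤ ENNReal.ofReal (D / (b - a)))
    {x₀ : ℝ} (hx₀ : x₀ ∈ Icc (-1 : ℝ) 1) :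
    ‖F (x₀, γ)‖ ≤ (1600 * C₀ + 2) * (n : ℝ) ^ (-α) := by
  have hn' : (2401 : ℝ) ≤ n := by exact_mod_cast hn
  have hn0 : (0 : ℝ) < n := by linarith
  have hρn : ((n : ℝ) ^ 100)⁻¹ ≤ (n : ℝ)⁻¹ :=
    inv_anti₀ hn0 (le_self_pow₀ (by linarith) (by norm_num))
  have hninv : (n : ℝ)⁻¹ ≤ 1 / 4 := by
    rw [one_div]; exact inv_anti₀ (by norm_num) (by linarith)
  have hB0 : 0 ≤ B := (norm_nonneg _).trans (hB (0, 0) (by constructor <;> constructor <;> norm_num))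
  have h := norm_le_of_moment_le hF hsupp hα0 hα1 hC₀ hH ((by positivity : 0 < (n : ℝ)⁻¹).trans_le hnγ)
    hγ (by omega : 2 ≤ n) (fun k hk γ' hγ' =>
      (norm_moment_le hF hsupp hB hγ.le hγ' (ρ := ((n : ℝ) ^ 100)⁻¹) (by positivity)
        (hρn.trans hninv) (hρn.trans hnγ) hD0
        (fun a b ha hab hb => hD a b ha hab (hb.trans hρn)) (j := n - 1) (by omega) k rfl).trans
      (moment_bound_le hn hk rfl hB0 hnB hD0 rfl)) hx₀
  have h2 : (2 : ℝ) / n ≤ 2 * (n : ℝ) ^ (-α) := by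
    rw [div_eq_mul_inv, ← Real.rpow_neg_one]
    gcongr
    linarith
  have := amplified_moment_bound_le hn hD0 hDn
  linarith

/-! ### Transfer to the Radon transform -/

lemma dist_vec_le (x y x' y' : ℝ) :
    dist (!₂[x, y] : EuclideanSpace ℝ (Fin 2)) !₂[x', y'] ≤ |x - x'| + |y - y'| := by
  rw [EuclideanSpace.dist_eq]
  simp only [Fin.sum_univ_two, Real.dist_eq, sq_abs]
  refine Real.sqrt_le_iff.mpr ⟨by positivity, ?_⟩
  simp
  nlinarith [sq_abs (x - x'), sq_abs (y - y'), abs_nonneg (x - x'), abs_nonneg (y - y'),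
    mul_nonneg (abs_nonneg (x - x')) (abs_nonneg (y - y'))]

lemma HolderWith.norm_sub_vec_le {f : EuclideanSpace ℝ (Fin 2) → ℂ} {C₀ α : ℝ≥0}
    (hf : HolderWith C₀ α f) (x y x' y' : ℝ) :
    ‖f !₂[x, y] - f !₂[x', y']‖ ≤ C₀ * (|x - x'| + |y - y'|) ^ (α : ℝ) := by
  rw [← dist_eq_norm]
  exact hf.dist_le_of_le (dist_vec_le x y x' y')

lemma eq_zero_of_lt_sq {f : EuclideanSpace ℝ (Fin 2) → ℂ} (hf : tsupport f ⊆ parabolicRegion)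
    (x y : ℝ) (h : y < x ^ 2) : f !₂[x, y] = 0 := by
  by_contra hne
  have h1 : x ^ 2 ≤ y := by
    simpa [parabolicRegion] using hf (subset_tsupport f hne)
  linarith

/-- Compare with the point `(x, -1)` below the region, at vertical distance at most `3`. -/
lemma norm_le_on_parabolaBox {F : ℝ × ℝ → ℂ} (hsupp : ∀ x y, y < x ^ 2 → F (x, y) = 0)
    {C₀ α : ℝ} (hα0 : 0 ≤ α) (hα1 : α ≤ 1) (hC₀ : 0 ≤ C₀)
    (hH : ∀ x y x' y', ‖F (x, y) - F (x', y')‖ ≤ C₀ * (|x - x'| + |y - y'|) ^ α)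
    {q : ℝ × ℝ} (hq : q ∈ parabolaBox) : ‖F q‖ ≤ 3 * C₀ := by
  obtain ⟨x, y⟩ := q
  have hy := hq.2
  simp only at hy
  have h := hH x y x (-1)
  rw [hsupp x (-1) (by nlinarith [sq_nonneg x]), sub_zero, sub_self, abs_zero, zero_add,
    abs_of_nonneg (by linarith [hy.1])] at h
  have h3 : (y - -1) ^ α ≤ 3 :=
    calc (y - -1) ^ α ≤ (3 : ℝ) ^ α :=
          Real.rpow_le_rpow (by linarith [hy.1]) (by linarith [hy.2]) hα0
      _ ≤ (3 : ℝ) ^ (1 : ℝ) := Real.rpow_le_rpow_of_exponent_le (by norm_num) hα1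
      _ = 3 := Real.rpow_one _
  nlinarith

/-- In every interval of slopes some slope has an at most average line integral. -/
lemma exists_slope_lintegral_le {g : ℝ × ℝ → ℂ} (hg : Continuous g) {ε γ D a b : ℝ}
    (hD : rectL1 ε γ g ≤ ENNReal.ofReal D) (ha : -ε ≤ a) (hab : a < b) (hb : b ≤ ε) :
    ∃ ξ ∈ Icc a b, ∫⁻ η in Ioo (-γ) γ, ‖g (ξ, η)‖ₑ ≤ ENNReal.ofReal (D / (b - a)) := by
  have hmeas : Measurable fun q : ℝ × ℝ => ‖g q‖ₑ := hg.enorm.measurable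
  have hv : Measurable fun ξ : ℝ => ∫⁻ η in Ioo (-γ) γ, ‖g (ξ, η)‖ₑ := hmeas.lintegral_prod_right'
  have hvol : volume (Icc a b) = ENNReal.ofReal (b - a) := Real.volume_Icc
  have hpos : 0 < b - a := sub_pos.mpr hab
  obtain ⟨ξ, hξ, hle⟩ := exists_le_setLAverage (μ := volume) (s := Icc a b)
    (by rw [hvol]; simpa using hab) (by rw [hvol]; exact ENNReal.ofReal_ne_top) hv.aemeasurable
  refine ⟨ξ, hξ, hle.trans ?_⟩
  rw [setLAverage_eq, hvol, ENNReal.ofReal_div_of_pos hpos]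
  gcongr
  refine le_trans ?_ hD
  rw [rectL1, Measure.volume_eq_prod, ← Measure.prod_restrict, lintegral_prod _ hmeas.aemeasurable]
  exact lintegral_mono_set (Icc_subset_Icc ha hb)

lemma exists_resolution_threshold (C : ℝ) {γ ε : ℝ} (hγ : 0 < γ) (hε : 0 < ε) :
    ∃ n₀ : ℕ, ∀ n ≥ n₀, 2401 ≤ n ∧ C ≤ n ∧ ((n : ℝ))⁻¹ ≤ γ ∧ ((n : ℝ))⁻¹ ≤ ε := by
  have h1 : Filter.Tendsto (fun n : ℕ => ((n : ℝ))⁻¹) Filter.atTop (nhds 0) :=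
    tendsto_inv_atTop_nhds_zero_nat
  have h2 : Filter.Tendsto (fun n : ℕ => (n : ℝ)) Filter.atTop Filter.atTop :=
    tendsto_natCast_atTop_atTop
  exact Filter.eventually_atTop.mp ((Filter.eventually_ge_atTop 2401).and
    ((h2.eventually_ge_atTop C).and ((h1.eventually_le_const hγ).and (h1.eventually_le_const hε))))

/-- The stability estimate at a given resolution `n`, for the Radon transform. -/
lemma norm_slice_le_of_rectL1_le {f : EuclideanSpace ℝ (Fin 2) → ℂ} {C₀ α : ℝ≥0}
    (hα0 : 0 < α) (hα1 : α ≤ 1) (hf : HolderWith C₀ α f) (hsupp : tsupport f ⊆ parabolicRegion)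
    {γ ε D : ℝ} (hγ : γ < 1) (hε : 0 < ε) (hD0 : 0 ≤ D)
    (hD : rectL1 ε γ (radon f) ≤ ENNReal.ofReal D) {n : ℕ}
    (hn : 2401 ≤ n ∧ 72 * (C₀ : ℝ) ≤ n ∧ ((n : ℝ))⁻¹ ≤ γ ∧ ((n : ℝ))⁻¹ ≤ ε)
    (hDn : D * (n : ℝ) ^ (1000 * n) ≤ 1) {x : ℝ} (hx : x ∈ Icc (-1 : ℝ) 1) :
    ‖f !₂[x, γ]‖ ≤ (1600 * C₀ + 2) * (n : ℝ) ^ (-(α : ℝ)) := by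
  obtain ⟨h1, h2, h3, h4⟩ := hn
  have hfc : Continuous f := hf.continuous hα0
  set F : ℝ × ℝ → ℂ := fun q => f !₂[q.1, q.2] with hFdef
  have hF : Continuous F := by
    refine hfc.comp ?_
    fun_prop
  have hs : ∀ x y, y < x ^ 2 → F (x, y) = 0 := eq_zero_of_lt_sq hsupp
  have hα1' : (α : ℝ) ≤ 1 := by exact_mod_cast hα1
  have hH : ∀ x y x' y', ‖F (x, y) - F (x', y')‖ ≤ C₀ * (|x - x'| + |y - y'|) ^ (α : ℝ) :=
    hf.norm_sub_vec_le
  have hg : Continuous (radon f) := continuous_lineIntegral hF hs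
  exact norm_le_of_lineIntegral_le hF hs α.coe_nonneg hα1' C₀.coe_nonneg hH (B := 3 * C₀)
    (fun q hq => norm_le_on_parabolaBox hs α.coe_nonneg hα1' C₀.coe_nonneg hH hq) hγ hD0 h1
    (by linarith) h3 hDn
    (fun a b ha hab hb => exists_slope_lintegral_le hg hD (by linarith) hab (hb.trans h4)) hx

lemma slice_eq_zero_of_notMem {f : EuclideanSpace ℝ (Fin 2) → ℂ}
    (hsupp : tsupport f ⊆ parabolicRegion) {γ x : ℝ} (hγ : γ < 1) (hx : x ∉ Icc (-1 : ℝ) 1) :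
    f !₂[x, γ] = 0 := by
  refine eq_zero_of_lt_sq hsupp x γ ?_
  by_contra! h
  exact hx ⟨by nlinarith, by nlinarith⟩

lemma eLpNorm_two_slice_le {f : EuclideanSpace ℝ (Fin 2) → ℂ}
    (hsupp : tsupport f ⊆ parabolicRegion) {γ S : ℝ} (hγ : γ < 1)
    (hS : ∀ x ∈ Icc (-1 : ℝ) 1, ‖f !₂[x, γ]‖ ≤ S) :
    eLpNorm (fun x : ℝ => f !₂[x, γ]) 2 volume ≤ ENNReal.ofReal (2 * S) := by
  have hS0 : 0 ≤ S := (norm_nonneg _).trans (hS 0 (by norm_num))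
  have h1 : eLpNorm (fun x : ℝ => f !₂[x, γ]) 2 volume ≤
      eLpNorm ((Icc (-1 : ℝ) 1).indicator fun _ => S) 2 volume := by
    refine eLpNorm_mono_real fun x => ?_
    by_cases hx : x ∈ Icc (-1 : ℝ) 1
    · rw [indicator_of_mem hx]; exact hS x hx
    · rw [indicator_of_notMem hx, slice_eq_zero_of_notMem hsupp hγ hx, norm_zero]
  refine h1.trans ?_
  rw [eLpNorm_indicator_const measurableSet_Icc (by norm_num) (by norm_num), Real.volume_Icc,
    Real.enorm_of_nonneg hS0, mul_comm 2 S, ENNReal.ofReal_mul hS0]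
  gcongr
  rw [ENNReal.ofReal_rpow_of_nonneg (by norm_num) (by positivity)]
  refine ENNReal.ofReal_le_ofReal ?_
  calc (1 - -1 : ℝ) ^ (1 / (2 : ℝ≥0∞).toReal) ≤ (1 - -1 : ℝ) ^ (1 : ℝ) :=
        Real.rpow_le_rpow_of_exponent_le (by norm_num) (by norm_num)
    _ = 2 := by norm_num

/-! ### Choice of the resolution and conclusion -/

/-- The choice of resolution `n ≈ L / (2000 log L)` balancing the two error terms. -/
lemma exists_log_threshold (n₀ : ℕ) (a : ℝ) : ∃ L₀ : ℝ, ∀ L ≥ L₀, a ≤ L ∧ ∃ n : ℕ, n₀ ≤ n ∧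
    (n : ℝ) ^ (1000 * n) ≤ Real.exp (L / 2) ∧
    ∀ α : ℝ, 0 ≤ α → α ≤ 1 → (n : ℝ) ^ (-α) ≤ 4000 * (Real.log L / L) ^ α := by
  have hlim : Filter.Tendsto (fun L : ℝ => L / Real.log L) Filter.atTop Filter.atTop := by
    have h := Real.isLittleO_log_id_atTop.tendsto_div_nhds_zero
    have h' : Filter.Tendsto (fun L : ℝ => Real.log L / L) Filter.atTop (nhdsWithin 0 (Ioi 0)) := by
      refine tendsto_nhdsWithin_iff.mpr ⟨h, ?_⟩
      filter_upwards [Filter.eventually_gt_atTop 1] with L hL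
      exact div_pos (Real.log_pos hL) (by linarith)
    refine h'.inv_tendsto_nhdsGT_zero.congr fun L => ?_
    simp
  obtain ⟨L₀, hL₀⟩ := Filter.eventually_atTop.mp
    ((hlim.eventually_ge_atTop (2000 * (n₀ + 1))).and
      ((Filter.eventually_ge_atTop a).and
        ((Filter.eventually_gt_atTop 1).and (Real.tendsto_log_atTop.eventually_ge_atTop 1))))
  refine ⟨L₀, fun L hL => ?_⟩
  obtain ⟨h1, h2, h3, h4⟩ := hL₀ L hL
  refine ⟨h2, ⌊L / Real.log L / 2000⌋₊, ?_⟩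
  set r := L / Real.log L with hr
  set n := ⌊r / 2000⌋₊ with hn
  have hlog : 0 < Real.log L := by linarith
  have hr2 : (n₀ : ℝ) + 1 ≤ r / 2000 := by linarith
  have hr0 : 0 < r := by positivity
  have hn1 : n₀ + 1 ≤ n := Nat.le_floor (by exact_mod_cast hr2)
  have hnr : (n : ℝ) ≤ r / 2000 := Nat.floor_le (by positivity)
  have hnpos : (1 : ℝ) ≤ n := by exact_mod_cast (by omega : 1 ≤ n)
  -- Since `1 ≤ n`, `r / 2000 < n + 1 ≤ 2 n`.
  have hnlow : r / 4000 ≤ n := by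
    have := Nat.lt_floor_add_one (r / 2000)
    rw [← hn] at this
    linarith
  have hrL : r ≤ L := div_le_self (by linarith) h4
  refine ⟨by omega, ?_, ?_⟩
  · have hlogn : Real.log n ≤ Real.log L := Real.log_le_log (by linarith) (by linarith)
    rw [← Real.exp_log (pow_pos (by linarith : (0 : ℝ) < n) _), Real.log_pow]
    refine Real.exp_le_exp.mpr ?_
    push_cast
    have hlogn0 : 0 ≤ Real.log n := Real.log_nonneg hnpos
    calc 1000 * (n : ℝ) * Real.log n ≤ 1000 * (r / 2000) * Real.log L := by gcongr
      _ = L / 2 := by rw [hr]; field_simp; norm_num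
  · intro α hα0 hα1
    calc (n : ℝ) ^ (-α) ≤ (r / 4000) ^ (-α) :=
          Real.rpow_le_rpow_of_nonpos (by positivity) hnlow (by linarith)
      _ = 4000 ^ α * (Real.log L / L) ^ α := by
          rw [Real.rpow_neg (by positivity), ← Real.inv_rpow (by positivity),
            ← Real.mul_rpow (by norm_num) (by positivity)]
          congr 1
          rw [hr]; field_simp
      _ ≤ 4000 ^ (1 : ℝ) * (Real.log L / L) ^ α := by
          gcongr
          norm_num
      _ = _ := by rw [Real.rpow_one]

theorem mainTheorem2 (C₀ : ℝ≥0) :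
    ∃ M : ℝ, 0 < M ∧
      ∀ α : ℝ≥0, 0 < α → α ≤ 1 →
      ∀ N : ℝ → ℝ → (ℝ × ℝ → ℂ) → ℝ≥0∞, IsDataNorm N →
      ∀ γ : ℝ, 0 < γ → γ < 1 →
      ∀ ε : ℝ, 0 < ε →
      ∃ δ : ℝ, 0 < δ ∧
        ∀ f : EuclideanSpace ℝ (Fin 2) → ℂ,
          HolderWith C₀ α f → tsupport f ⊆ parabolicRegion →
          (∀ H : ℝ, 0 < H → H < δ → N ε γ (radon f) = ENNReal.ofReal H →
            eLpNorm (fun x : ℝ => f !₂[x, γ]) 2 volume ≤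
              ENNReal.ofReal
                (M * (Real.log (Real.log (1 / H)) / Real.log (1 / H)) ^ (α : ℝ))) ∧
          (N ε γ (radon f) = 0 → ∀ x : ℝ, f !₂[x, γ] = 0) := by
  -- The factor `2` dominates the `√2` from the `L²` norm on `[-1, 1]`; `4000` comes from rounding
  -- the resolution.
  refine ⟨2 * ((1600 * C₀ + 2) * 4000), by positivity, ?_⟩
  intro α hα0 hα1 N hN γ hγ0 hγ1 ε hε
  obtain ⟨c, hc, hdom⟩ := hN.dominates
  obtain ⟨n₀, hn₀⟩ := exists_resolution_threshold (72 * C₀) hγ0 hε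
  -- Amplification uses up half of the smallness `exp (-L)`; `L ≥ -2 log c` lets the other half
  -- absorb the constant `c`.
  obtain ⟨L₀, hL₀⟩ := exists_log_threshold n₀ (-2 * Real.log c)
  have hα1' : (α : ℝ) ≤ 1 := by exact_mod_cast hα1
  have hc' : (0 : ℝ) < c := by exact_mod_cast hc
  refine ⟨Real.exp (-L₀), Real.exp_pos _, fun f hf hsupp => ?_⟩
  have hg : Continuous (radon f) :=
    continuous_lineIntegral (F := fun q => f !₂[q.1, q.2])
      ((hf.continuous hα0).comp (by fun_prop)) (eq_zero_of_lt_sq hsupp)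
  have hrect : ∀ H : ℝ, N ε γ (radon f) = ENNReal.ofReal H →
      rectL1 ε γ (radon f) ≤ ENNReal.ofReal (H / c) := by
    intro H hNH
    have h1 := hdom ε γ hε hγ0 hγ1 (radon f) hg
    rw [hNH] at h1
    rw [ENNReal.ofReal_div_of_pos hc', ENNReal.ofReal_coe_nnreal,
      ENNReal.le_div_iff_mul_le (Or.inl (by exact_mod_cast hc.ne')) (Or.inl ENNReal.coe_ne_top),
      mul_comm]
    exact (mul_le_mul_right (le_max_left _ _) _).trans h1
  refine ⟨fun H hH0 hHδ hNH => ?_, fun hN0 x => ?_⟩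
  · set L := Real.log (1 / H) with hL
    have hHL : H = Real.exp (-L) := by
      rw [hL, one_div, Real.log_inv, neg_neg, Real.exp_log hH0]
    have hLL : L₀ ≤ L := by
      rw [hHL, Real.exp_lt_exp] at hHδ
      linarith
    obtain ⟨ha, n, hn, hnpow, hnα⟩ := hL₀ L hLL
    have hDn : H / c * (n : ℝ) ^ (1000 * n) ≤ 1 := by
      rw [div_mul_eq_mul_div, div_le_one hc']
      calc H * (n : ℝ) ^ (1000 * n) ≤ Real.exp (-L) * Real.exp (L / 2) := by
            rw [← hHL]; gcongr
        _ = Real.exp (-L / 2) := by rw [← Real.exp_add]; ring_nf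
        _ ≤ Real.exp (Real.log c) := Real.exp_le_exp.mpr (by linarith)
        _ = c := Real.exp_log hc'
    refine (eLpNorm_two_slice_le hsupp hγ1 fun x hx => norm_slice_le_of_rectL1_le hα0 hα1 hf hsupp
      hγ1 hε (by positivity) (hrect H hNH) (hn₀ n hn) hDn hx).trans ?_
    refine ENNReal.ofReal_le_ofReal ?_
    rw [mul_assoc 2, mul_assoc (1600 * (C₀ : ℝ) + 2)]
    gcongr
    exact hnα α α.coe_nonneg hα1'
  · by_cases hx : x ∈ Icc (-1 : ℝ) 1
    -- With `D = 0` the constraint linking `n` to the data is void, so `n` can tend to infinity.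
    · have hbound : ∀ᶠ n : ℕ in Filter.atTop,
          ‖f !₂[x, γ]‖ ≤ (1600 * C₀ + 2) * (n : ℝ) ^ (-(α : ℝ)) := by
        filter_upwards [Filter.eventually_ge_atTop n₀] with n hn
        refine norm_slice_le_of_rectL1_le (D := 0) hα0 hα1 hf hsupp hγ1 hε le_rfl ?_ (hn₀ n hn)
          (by simp) hx
        simpa using hrect 0 (by simpa using hN0)
      have hlim : Filter.Tendsto (fun n : ℕ => (1600 * (C₀ : ℝ) + 2) * (n : ℝ) ^ (-(α : ℝ)))
          Filter.atTop (nhds 0) := by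
        have h := ((tendsto_rpow_neg_atTop (y := (α : ℝ)) (by exact_mod_cast hα0)).comp
          tendsto_natCast_atTop_atTop).const_mul (1600 * (C₀ : ℝ) + 2)
        simpa using h
      exact norm_le_zero_iff.mp (ge_of_tendsto hlim hbound)
    · exact slice_eq_zero_of_notMem hsupp hγ1 hx
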